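/- **Transfer regret of BIAS-OFUL with a fixed bias.** Let $d,T\ge 1$ be integers, $\lambda\ge 1$, $R,L\ge 0$, $h\in\mathbb{R}^d$ with $\|h\|_2\le S$, and let $\rho$ be a probability distribution on $\mathbb{R}^d$ with $\|w\|_2\le S$ for $\rho$-almost every $w$. For a task $w\sim\rho$, in each round $t=1,\dots,T$ the learner receives a decision set $\mathcal{D}_t\subseteq\mathbb{R}^d$ (which may depend on the task and on the past) such that $\|x\|_2\le L$ and $x^\top w\in[-1,1]$ for all $x\in\mathcal{D}_t$, pulls an arm $x_t\in\mathcal{D}_t$, and observes $y_t=x_t^\top w+\eta_t$. The noise $\eta_t$ is $R$-sub-Gaussian conditionally on the past $\mathcal{F}_{t-1}$, that is, $\mathbb{E}[e^{s\eta_t}\mid\mathcal{F}_{t-1}]\le e^{s^2R^2/2}$ for all $s\in\mathbb{R}$, and $x_t$ is $\mathcal{F}_{t-1}$-measurable. The arms are those of BIAS-OFUL with bias $h$ and $\delta=1/T$: $$x_t\in\arg\max_{x\in\mathcal{D}_t}\Big\{x^\top\widehat w^h_{t-1}+\beta^h_{t-1}(1/T)\,\sqrt{x^\top V_{t-1}^{-1}x}\Big\},\qquad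 V_t=\lambda I+\sum_{s\le t}x_sx_s^\top,$$ $$\widehat w^h_t=V_t^{-1}\sum_{s\le t}x_s\,(y_s-x_s^\top h)+h,\qquad \beta^h_t(\delta)=\lambda^{1/2}\|h-w\|_2+R\sqrt{2\log\frac{\det(V_t)^{1/2}}{\det(\lambda I)^{1/2}\,\delta}}.$$ Let $x_t^*\in\arg\max_{x\in\mathcal{D}_t}x^\top w$ be an optimal arm, $R(T,w)=\sum_{t=1}^T(x_t^*-x_t)^\top w$ the pseudo-regret, and let $\mathcal{R}(T,\rho)=\mathbb{E}_{w\sim\rho}\big[\mathbb{E}[R(T,w)]\big]$ be the transfer regret (the inner expectation is over the noise and any other randomness within the task). Put $\mathrm{Mar}_h=\mathbb{E}_{w\sim\rho}\|w-h\|_2$ and $\mathrm{Var}_h=\mathbb{E}_{w\sim\rho}\|w-h\|_2^2$. Then there is an absolute constant $C>0$ (independent of all the quantities above) such that the pseudo-regret is integrable and $$\mathcal{R}(T,\rho)\le \max(1,L)^2\,B,$$ where $$B = C\sqrt{Td\lambda\log\Big(1+\tfrac{TL}{\lambda d}\Big)}\;\mathrm{Mar}_h+RCd\sqrt{T\log\Big(T+\tfrac{T^2L}{\lambda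 d}\Big)\log\Big(1+\tfrac{TL}{\lambda d}\Big)},$$ and moreover $$B\le C\sqrt{Td\lambda\log\Big(1+\tfrac{TL}{\lambda d}\Big)\mathrm{Var}_h}+RCd\sqrt{T\log\Big(T+\tfrac{T^2L}{\lambda d}\Big)\log\Big(1+\tfrac{TL}{\lambda d}\Big)}.$$ In particular, for $L\le 1$ both bounds hold for $\mathcal{R}(T,\rho)$ with the absolute constant $C$, and for general $L$ they hold with a constant depending only on $L$. -/

import Mathlib

open MeasureTheory ProbabilityTheory

noncomputable section

namespace BiasOFUL

/-- Arms, task parameters and biases are vectors of `ℝᵈ` with the Euclidean norm. -/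
abbrev Vec (d : ℕ) := EuclideanSpace ℝ (Fin d)

/-! Rounds are numbered `0, 1, …, T - 1`, so that `x t` is the arm pulled in the `(t + 1)`-st round,
and quantities indexed by `t` such as `designMatrix lam x t` use the first `t` rounds. -/

/-- The regularized design matrix `λ I + ∑_{s < t} x_s x_sᵀ` after `t` rounds. -/
def designMatrix {d : ℕ} (lam : ℝ) (x : ℕ → Vec d) (t : ℕ) : Matrix (Fin d) (Fin d) ℝ :=
  lam • (1 : Matrix (Fin d) (Fin d) ℝ) +
    ∑ s ∈ Finset.range t, Matrix.vecMulVec (x s).ofLp (x s).ofLp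

/-- The weighted norm `√(zᵀ A z)`. -/
def weightedNorm {d : ℕ} (A : Matrix (Fin d) (Fin d) ℝ) (z : Vec d) : ℝ :=
  √(z.ofLp ⬝ᵥ (A.mulVec z.ofLp))

/-- The ridge estimate biased towards `h` after `t` rounds, `V⁻¹ Xᵀ (Y - X h) + h`, where `X` has
rows `x_s`, `Y` has entries `y_s` (`s < t`), and `V` is the regularized design matrix. -/
def biasedEstimate {d : ℕ} (lam : ℝ) (h : Vec d) (x : ℕ → Vec d) (y : ℕ → ℝ) (t : ℕ) : Vec d :=
  WithLp.toLp 2 ((designMatrix lam x t)⁻¹.mulVec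
    (∑ s ∈ Finset.range t, (y s - inner ℝ (x s) h) • x s).ofLp) + h

/-- The confidence radius after `t` rounds at level `δ`:
`√λ ‖h - w‖ + R √(2 log (det(V)^{1/2} / (det(λ I)^{1/2} δ)))`. -/
def confidenceRadius {d : ℕ} (lam R δ : ℝ) (h w : Vec d) (x : ℕ → Vec d) (t : ℕ) : ℝ :=
  √lam * ‖h - w‖ + R * √(2 * Real.log (√(designMatrix lam x t).det /
    (√(lam • (1 : Matrix (Fin d) (Fin d) ℝ)).det * δ)))

/-- The optimistic index of an arm `z` after `t` rounds:
`zᵀ ŵ_t + β_t(δ) ‖z‖_{V_t⁻¹}`. -/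
def optimisticIndex {d : ℕ} (lam R δ : ℝ) (h w : Vec d) (x : ℕ → Vec d) (y : ℕ → ℝ) (t : ℕ)
    (z : Vec d) : ℝ :=
  inner ℝ z (biasedEstimate lam h x y t) +
    confidenceRadius lam R δ h w x t * weightedNorm (designMatrix lam x t)⁻¹ z

/-- The arms `x` are a run of BIAS-OFUL over `T` rounds, with regularization `lam`, bias `h` and
confidence level `δ = 1 / T`, on the task `w` with decision sets `D` and noise `η`: in each round
the arm pulled maximizes the optimistic index computed from the past arms and the past rewards
`y_s = ⟨x_s, w⟩ + η_s`. -/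
def IsRun {d : ℕ} (T : ℕ) (lam R : ℝ) (h w : Vec d) (D : ℕ → Set (Vec d)) (η : ℕ → ℝ)
    (x : ℕ → Vec d) : Prop :=
  ∀ t < T, x t ∈ D t ∧
    IsMaxOn (optimisticIndex lam R (1 / (T : ℝ)) h w x (fun s => inner ℝ (x s) w + η s) t)
      (D t) (x t)

/-- `X` is `R`-sub-Gaussian conditionally on the sub-σ-algebra `m`:
`E[exp (s X) | m] ≤ exp (s² R² / 2)` almost surely, for every real `s`. -/
def CondSubgaussian {Ω : Type*} (m : MeasurableSpace Ω) {m0 : MeasurableSpace Ω} (X : Ω → ℝ)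
    (R : ℝ) (μ : Measure Ω) : Prop :=
  ∀ s : ℝ, Integrable (fun ω => Real.exp (s * X ω)) μ ∧
    μ[fun ω => Real.exp (s * X ω) | m] ≤ᵐ[μ] fun _ => Real.exp (s ^ 2 * R ^ 2 / 2)

/-- The pseudo-regret `∑_{t < T} ⟨x*_t - x_t, w⟩`. -/
def pseudoRegret {d : ℕ} (T : ℕ) (w : Vec d) (xstar x : ℕ → Vec d) : ℝ :=
  ∑ t ∈ Finset.range T, inner ℝ (xstar t - x t) w

/-- The transfer regret `E_{w ∼ ρ} [E [R(T, w)]]`, where the inner expectation is taken with respect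
to the law `κ w` of the randomness met while solving the task `w`. -/
def transferRegret {d : ℕ} {Ω : Type*} [MeasurableSpace Ω] (T : ℕ) (ρ : Measure (Vec d))
    (κ : Kernel (Vec d) Ω) (xstar x : ℕ → Vec d → Ω → Vec d) : ℝ :=
  ∫ w, (∫ ω, pseudoRegret T w (fun t => xstar t w ω) (fun t => x t w ω) ∂(κ w)) ∂ρ

/-- The variance of the task distribution `ρ` relative to `h`. -/
def taskVar {d : ℕ} (ρ : Measure (Vec d)) (h : Vec d) : ℝ := ∫ w, ‖w - h‖ ^ 2 ∂ρ

/-- The mean absolute distance of the task distribution `ρ` to `h`. -/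
def taskMar {d : ℕ} (ρ : Measure (Vec d)) (h : Vec d) : ℝ := ∫ w, ‖w - h‖ ∂ρ

end BiasOFUL

end

open MeasureTheory ProbabilityTheory

noncomputable section

/-! The usual optimism argument is run in expectation, with no high-probability event. By
`inner_biasedEstimate_sub`, the estimation error in a direction is at most its `V⁻¹`-norm times
`√lam * ‖h - w‖` plus the self-normalized noise `R * N`, where `N = ‖∑ e_s x_s‖_{V⁻¹}` and `η = R *
e`. The confidence radius has `a = √(2 log T + log (det V / det (lam I)))` in place of `N`, so one
round costs twice the optimistic width plus a multiple of `R` times a bound on the excess `N - a`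
(`inner_sub_le_of_isMaxOn`).

The excess is controlled by `b - a ≤ exp ((b² - a²) / 2)`: with `b = N` the right side is exactly
`M_t / T`, where `M_t` is the mixture likelihood ratio. Since `M_t` has mean at most one
(`lintegral_mixtureLikelihood_le`), the expected excess bounds sum to at most `(T - 1) / T`, which
the main rate absorbs (`div_sqrt_mul_le`).

The widths are summed by Cauchy–Schwarz, the elliptical potential lemma and a determinant–trace
bound (`sum_confidenceRadius_mul_le`). The task-dependent part is linear in `‖w - h‖`, so averaging
over `ρ` gives `taskMar`, and nonnegativity of a variance gives the bound by `taskVar`. -/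

namespace BiasOFUL

/-! ### Rank-one updates and determinant bounds for positive definite matrices. -/

section LinearAlgebra

variable {n : Type*} [Fintype n]

theorem dotProduct_mulVec_comm_of_isHermitian {A : Matrix n n ℝ} (hA : A.IsHermitian)
    (u v : n → ℝ) : u ⬝ᵥ A.mulVec v = v ⬝ᵥ A.mulVec u := by
  have hT : A.transpose = A := by
    rw [← Matrix.conjTranspose_eq_transpose_of_trivial, hA.eq]
  rw [Matrix.dotProduct_mulVec, ← Matrix.mulVec_transpose, hT, dotProduct_comm]

/-- Cauchy–Schwarz for a semidefinite form: the quadratic `t ↦ (u + t v)ᵀ A (u + t v)` is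
nonnegative, so its discriminant is not positive. -/
theorem sq_dotProduct_mulVec_le {A : Matrix n n ℝ} (hA : A.PosSemidef) (u v : n → ℝ) :
    (u ⬝ᵥ A.mulVec v) ^ 2 ≤ (u ⬝ᵥ A.mulVec u) * (v ⬝ᵥ A.mulVec v) := by
  have hpos : ∀ z : n → ℝ, 0 ≤ z ⬝ᵥ A.mulVec z := fun z => by
    simpa using hA.dotProduct_mulVec_nonneg z
  have key : ∀ t : ℝ, 0 ≤ (v ⬝ᵥ A.mulVec v) * (t * t) + 2 * (u ⬝ᵥ A.mulVec v) * t +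
      u ⬝ᵥ A.mulVec u := fun t => by
    have h := hpos (u + t • v)
    have hc := dotProduct_mulVec_comm_of_isHermitian hA.isHermitian v u
    simp only [Matrix.mulVec_add, Matrix.mulVec_smul, add_dotProduct, dotProduct_add,
      smul_dotProduct, dotProduct_smul, smul_eq_mul, hc] at h
    linarith
  have := discrim_le_zero key
  rw [discrim] at this
  linarith

variable [DecidableEq n]

/-- Sherman–Morrison, checked by applying the updated matrix to the claimed vector. -/
theorem inv_add_vecMulVec_mulVec {A : Matrix n n ℝ} (hA : A.PosDef) (x v : n → ℝ) :
    (A + Matrix.vecMulVec x x)⁻¹.mulVec v =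
      A⁻¹.mulVec v - ((x ⬝ᵥ A⁻¹.mulVec v) / (1 + x ⬝ᵥ A⁻¹.mulVec x)) • A⁻¹.mulVec x := by
  have hq : 0 ≤ x ⬝ᵥ A⁻¹.mulVec x := by
    simpa using hA.inv.posSemidef.dotProduct_mulVec_nonneg x
  have hA' : (A + Matrix.vecMulVec x x).PosDef :=
    hA.add_posSemidef (by simpa using Matrix.posSemidef_vecMulVec_self_star x)
  have hu := (Matrix.isUnit_iff_isUnit_det _).1 hA.isUnit
  have hu' := (Matrix.isUnit_iff_isUnit_det _).1 hA'.isUnit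
  have hv : (A + Matrix.vecMulVec x x).mulVec (A⁻¹.mulVec v -
      ((x ⬝ᵥ A⁻¹.mulVec v) / (1 + x ⬝ᵥ A⁻¹.mulVec x)) • A⁻¹.mulVec x) = v := by
    have hi : ∀ u, A.mulVec (A⁻¹.mulVec u) = u := fun u => by
      rw [Matrix.mulVec_mulVec, Matrix.mul_nonsing_inv _ hu, Matrix.one_mulVec]
    simp only [Matrix.mulVec_sub, Matrix.add_mulVec, Matrix.mulVec_smul, hi,
      Matrix.vecMulVec_mulVec]
    ext i
    simp
    field_simp
    ring
  conv_lhs => rw [← hv]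
  rw [Matrix.mulVec_mulVec, Matrix.nonsing_inv_mul _ hu', Matrix.one_mulVec]

theorem quadForm_inv_add_vecMulVec {A : Matrix n n ℝ} (hA : A.PosDef) (x S : n → ℝ) (e : ℝ) :
    (S + e • x) ⬝ᵥ (A + Matrix.vecMulVec x x)⁻¹.mulVec (S + e • x) =
      S ⬝ᵥ A⁻¹.mulVec S +
        (e ^ 2 * (x ⬝ᵥ A⁻¹.mulVec x) + 2 * e * (x ⬝ᵥ A⁻¹.mulVec S) - (x ⬝ᵥ A⁻¹.mulVec S) ^ 2) /
          (1 + x ⬝ᵥ A⁻¹.mulVec x) := by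
  have hq : 0 ≤ x ⬝ᵥ A⁻¹.mulVec x := by
    simpa using hA.inv.posSemidef.dotProduct_mulVec_nonneg x
  rw [inv_add_vecMulVec_mulVec hA]
  have hc := dotProduct_mulVec_comm_of_isHermitian hA.inv.isHermitian S x
  simp only [Matrix.mulVec_add, Matrix.mulVec_smul, add_dotProduct, dotProduct_add, dotProduct_sub,
      smul_dotProduct, dotProduct_smul, smul_eq_mul, hc]
  field_simp
  ring

theorem det_add_vecMulVec {A : Matrix n n ℝ} (hA : A.PosDef) (x : n → ℝ) :
    (A + Matrix.vecMulVec x x).det = A.det * (1 + x ⬝ᵥ A⁻¹.mulVec x) := by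
  have hu := (Matrix.isUnit_iff_isUnit_det _).1 hA.isUnit
  rw [Matrix.vecMulVec_eq Unit, Matrix.det_add_replicateCol_mul_replicateRow hu]
  congr 1
  rw [Matrix.det_unique]
  simp [Matrix.mul_assoc, Matrix.mul_apply, dotProduct, Matrix.mulVec, Finset.mul_sum]

/-- AM–GM for the eigenvalues: multiply the inequalities `a / c ≤ exp (a / c - 1)`; the exponents
add up to `trace / c - n ≤ 0`. -/
theorem det_le_pow_of_trace_le {A : Matrix n n ℝ} (hA : A.PosSemidef) {c : ℝ} (hc : 0 < c)
    (htr : A.trace ≤ Fintype.card n * c) : A.det ≤ c ^ Fintype.card n := by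
  have h0 := hA.eigenvalues_nonneg
  rw [hA.isHermitian.trace_eq_sum_eigenvalues] at htr
  rw [hA.isHermitian.det_eq_prod_eigenvalues]
  simp only [RCLike.ofReal_real_eq_id, id_eq] at *
  calc ∏ i, hA.isHermitian.eigenvalues i
      ≤ ∏ i, c * Real.exp (hA.isHermitian.eigenvalues i / c - 1) := by
        refine Finset.prod_le_prod (fun i _ => h0 i) fun i _ => ?_
        have := Real.add_one_le_exp (hA.isHermitian.eigenvalues i / c - 1)
        calc _ = c * (hA.isHermitian.eigenvalues i / c) := by field_simp
          _ ≤ _ := by gcongr; linarith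
    _ = c ^ Fintype.card n *
        Real.exp ((∑ i, hA.isHermitian.eigenvalues i) / c - Fintype.card n) := by
        rw [Finset.prod_mul_distrib, ← Real.exp_sum]
        simp [Finset.sum_div]
    _ ≤ c ^ Fintype.card n * 1 := by
        gcongr
        rw [Real.exp_le_one_iff, sub_nonpos, div_le_iff₀ hc]
        exact htr
    _ = _ := mul_one _

end LinearAlgebra

/-! ### The design matrix, its determinant ratio and the elliptical potential. -/

section Design

variable {d : ℕ} {lam : ℝ} {x : ℕ → Vec d}

theorem designMatrix_zero (lam : ℝ) (x : ℕ → Vec d) :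
    designMatrix lam x 0 = lam • (1 : Matrix (Fin d) (Fin d) ℝ) := by
  simp [designMatrix]

theorem designMatrix_succ (lam : ℝ) (x : ℕ → Vec d) (t : ℕ) :
    designMatrix lam x (t + 1) =
      designMatrix lam x t + Matrix.vecMulVec (x t).ofLp (x t).ofLp := by
  simp [designMatrix, Finset.sum_range_succ, add_assoc]

theorem posDef_designMatrix (hlam : 0 < lam) (x : ℕ → Vec d) (t : ℕ) :
    (designMatrix lam x t).PosDef := by
  induction t with
  | zero => rw [designMatrix_zero]; exact Matrix.PosDef.one.smul hlam
  | succ t ih =>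
    rw [designMatrix_succ]
    exact ih.add_posSemidef (by simpa using Matrix.posSemidef_vecMulVec_self_star (x t).ofLp)

theorem weightedNorm_nonneg (A : Matrix (Fin d) (Fin d) ℝ) (z : Vec d) : 0 ≤ weightedNorm A z :=
  Real.sqrt_nonneg _

theorem sq_weightedNorm {A : Matrix (Fin d) (Fin d) ℝ} (hA : A.PosSemidef) (z : Vec d) :
    weightedNorm A z ^ 2 = z.ofLp ⬝ᵥ A.mulVec z.ofLp :=
  Real.sq_sqrt (by simpa using hA.dotProduct_mulVec_nonneg z.ofLp)

theorem abs_dotProduct_mulVec_le {A : Matrix (Fin d) (Fin d) ℝ} (hA : A.PosSemidef) (u v : Vec d) :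
    |u.ofLp ⬝ᵥ A.mulVec v.ofLp| ≤ weightedNorm A u * weightedNorm A v := by
  refine abs_le_of_sq_le_sq ?_ (mul_nonneg (weightedNorm_nonneg _ _) (weightedNorm_nonneg _ _))
  rw [mul_pow, sq_weightedNorm hA, sq_weightedNorm hA]
  exact sq_dotProduct_mulVec_le hA _ _

theorem inner_eq_dotProduct (u v : Vec d) : inner ℝ u v = u.ofLp ⬝ᵥ v.ofLp := by
  simp [EuclideanSpace.inner_eq_star_dotProduct, dotProduct_comm]

theorem mul_dotProduct_self_le_designMatrix (lam : ℝ) (x : ℕ → Vec d) (t : ℕ) (v : Fin d → ℝ) :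
    lam * (v ⬝ᵥ v) ≤ v ⬝ᵥ (designMatrix lam x t).mulVec v := by
  induction t with
  | zero => simp [designMatrix_zero, Matrix.smul_mulVec]
  | succ t ih =>
    rw [designMatrix_succ, Matrix.add_mulVec, dotProduct_add, Matrix.vecMulVec_mulVec]
    have : v ⬝ᵥ (MulOpposite.op ((x t).ofLp ⬝ᵥ v) • (x t).ofLp) = ((x t).ofLp ⬝ᵥ v) ^ 2 := by
      simp [dotProduct_comm v, sq]
    rw [this]
    nlinarith [sq_nonneg ((x t).ofLp ⬝ᵥ v)]

/-- For `v = V⁻¹ z`, the bound `V ≥ lam I` and Cauchy–Schwarz give `lam ‖v‖² ≤ zᵀ v ≤ ‖z‖ ‖v‖`, so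
`lam ‖v‖ ≤ ‖z‖` and `zᵀ V⁻¹ z ≤ ‖z‖² / lam`. -/
theorem weightedNorm_inv_designMatrix_le (hlam : 0 < lam) (x : ℕ → Vec d) (t : ℕ) (z : Vec d) :
    weightedNorm (designMatrix lam x t)⁻¹ z ≤ ‖z‖ / √lam := by
  have hA := posDef_designMatrix hlam x t
  have hu := (Matrix.isUnit_iff_isUnit_det _).1 hA.isUnit
  set A := designMatrix lam x t
  set v := A⁻¹.mulVec z.ofLp with hv
  have hAv : A.mulVec v = z.ofLp := by
    rw [hv, Matrix.mulVec_mulVec, Matrix.mul_nonsing_inv _ hu, Matrix.one_mulVec]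
  have h1 : lam * (v ⬝ᵥ v) ≤ z.ofLp ⬝ᵥ v := by
    have := mul_dotProduct_self_le_designMatrix lam x t v
    rwa [show designMatrix lam x t = A from rfl, hAv, dotProduct_comm v z.ofLp] at this
  have h2 : z.ofLp ⬝ᵥ v ≤ ‖z‖ * ‖(WithLp.toLp 2 v : Vec d)‖ := by
    have := real_inner_le_norm z (WithLp.toLp 2 v : Vec d)
    rwa [inner_eq_dotProduct] at this
  have h3 : v ⬝ᵥ v = ‖(WithLp.toLp 2 v : Vec d)‖ ^ 2 := by
    rw [← real_inner_self_eq_norm_sq, inner_eq_dotProduct]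
  rw [h3] at h1
  rw [weightedNorm, ← Real.sqrt_sq (norm_nonneg z), ← Real.sqrt_div (sq_nonneg _)]
  refine Real.sqrt_le_sqrt ?_
  rw [← hv, le_div_iff₀ hlam]
  have hz := norm_nonneg z
  have hn := norm_nonneg (WithLp.toLp 2 v : Vec d)
  set a := ‖z‖
  set b := ‖(WithLp.toLp 2 v : Vec d)‖
  have h4 : lam * b ≤ a := by
    rcases hn.eq_or_lt with hb | hb
    · rw [← hb]; simpa using hz
    · have : lam * b * b ≤ a * b := by nlinarith
      exact le_of_mul_le_mul_right this hb
  nlinarith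

theorem det_designMatrix_succ (hlam : 0 < lam) (x : ℕ → Vec d) (t : ℕ) :
    (designMatrix lam x (t + 1)).det = (designMatrix lam x t).det *
      (1 + weightedNorm (designMatrix lam x t)⁻¹ (x t) ^ 2) := by
  have hA := posDef_designMatrix hlam x t
  rw [designMatrix_succ, det_add_vecMulVec hA, sq_weightedNorm hA.inv.posSemidef]

theorem det_designMatrix_mono (hlam : 0 < lam) (x : ℕ → Vec d) :
    Monotone fun t => (designMatrix lam x t).det := by
  refine monotone_nat_of_le_succ fun t => ?_
  rw [det_designMatrix_succ hlam]
  have := (posDef_designMatrix hlam x t).det_pos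
  nlinarith [sq_nonneg (weightedNorm (designMatrix lam x t)⁻¹ (x t))]

/-- The ratio `det V_t / det (λ I)`. -/
def detRatio (lam : ℝ) (x : ℕ → Vec d) (t : ℕ) : ℝ :=
  (designMatrix lam x t).det / (lam • (1 : Matrix (Fin d) (Fin d) ℝ)).det

theorem detRatio_zero (hlam : 0 < lam) (x : ℕ → Vec d) : detRatio lam x 0 = 1 := by
  rw [detRatio, designMatrix_zero, div_self]
  simp [hlam.ne']

theorem detRatio_succ (hlam : 0 < lam) (x : ℕ → Vec d) (t : ℕ) :
    detRatio lam x (t + 1) = detRatio lam x t *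
      (1 + weightedNorm (designMatrix lam x t)⁻¹ (x t) ^ 2) := by
  rw [detRatio, det_designMatrix_succ hlam, detRatio]; ring

theorem detRatio_mono (hlam : 0 < lam) (x : ℕ → Vec d) : Monotone (detRatio lam x) := fun s t h => by
  refine div_le_div_of_nonneg_right (det_designMatrix_mono hlam x h) ?_
  simpa using pow_nonneg hlam.le d

theorem one_le_detRatio (hlam : 0 < lam) (x : ℕ → Vec d) (t : ℕ) : 1 ≤ detRatio lam x t := by
  rw [← detRatio_zero hlam x]; exact detRatio_mono hlam x (Nat.zero_le t)

theorem detRatio_le (hd : 0 < d) (hlam : 0 < lam) {L : ℝ} {t : ℕ} (hx : ∀ s < t, ‖x s‖ ≤ L) :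
    detRatio lam x t ≤ (1 + t * L ^ 2 / (lam * d)) ^ d := by
  have hd' : (0 : ℝ) < d := Nat.cast_pos.2 hd
  have htr : (designMatrix lam x t).trace ≤ d * lam + t * L ^ 2 := by
    rw [designMatrix, Matrix.trace_add, Matrix.trace_sum, Matrix.trace_smul, Matrix.trace_one]
    have : ∀ s ∈ Finset.range t, (Matrix.vecMulVec (x s).ofLp (x s).ofLp).trace ≤ L ^ 2 := by
      intro s hs
      rw [Matrix.trace_vecMulVec, ← inner_eq_dotProduct, real_inner_self_eq_norm_sq]
      exact pow_le_pow_left₀ (norm_nonneg _) (hx s (Finset.mem_range.1 hs)) 2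
    have := Finset.sum_le_sum this
    simp at this ⊢
    linarith
  have h := det_le_pow_of_trace_le (posDef_designMatrix hlam x t).posSemidef
    (c := lam + t * L ^ 2 / d) (by positivity) (by
      rw [Fintype.card_fin, mul_add, mul_div_cancel₀ _ hd'.ne']; exact htr)
  rw [Fintype.card_fin] at h
  rw [detRatio, div_le_iff₀ (by simpa using pow_pos hlam d)]
  simp only [Matrix.det_smul, Matrix.det_one, mul_one, Fintype.card_fin]
  rw [← mul_pow]
  have he : (1 + t * L ^ 2 / (lam * d)) * lam = lam + t * L ^ 2 / d := by field_simp
  rw [he]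
  exact h

/-- Replaces the usual truncation `min 1 q` in the potential argument: `log (1 + q) ≥ log (1 + q /
c) ≥ q / (c + q) ≥ q / (2c)`. -/
theorem le_two_mul_log_one_add {q c : ℝ} (hc : 1 ≤ c) (hq : 0 ≤ q) (hqc : q ≤ c) :
    q ≤ 2 * c * Real.log (1 + q) := by
  have hc0 : 0 < c := by linarith
  have h1 : 1 - (1 + q / c)⁻¹ ≤ Real.log (1 + q / c) :=
    Real.one_sub_inv_le_log_of_pos (by positivity)
  have h2 : Real.log (1 + q / c) ≤ Real.log (1 + q) := by
    refine Real.log_le_log (by positivity) ?_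
    have : q / c ≤ q := div_le_self hq hc
    linarith
  have h3 : q / (2 * c) ≤ 1 - (1 + q / c)⁻¹ := by
    have : 1 - (1 + q / c)⁻¹ = q / (c + q) := by field_simp; ring
    rw [this]
    gcongr
    linarith
  have h4 := (h3.trans h1).trans h2
  rw [div_le_iff₀ (by positivity)] at h4
  linarith

/-- The elliptical potential lemma. -/
theorem sum_sq_weightedNorm_le (hlam : 1 ≤ lam) {c : ℝ} (hc : 1 ≤ c) {t : ℕ}
    (hx : ∀ s < t, ‖x s‖ ^ 2 ≤ c) :
    ∑ s ∈ Finset.range t, weightedNorm (designMatrix lam x s)⁻¹ (x s) ^ 2 ≤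
      2 * c * Real.log (detRatio lam x t) := by
  have hlam0 : 0 < lam := by linarith
  induction t with
  | zero => simp [detRatio_zero hlam0]
  | succ t ih =>
    have hq := sq_nonneg (weightedNorm (designMatrix lam x t)⁻¹ (x t))
    have hqc : weightedNorm (designMatrix lam x t)⁻¹ (x t) ^ 2 ≤ c := by
      have h1 := weightedNorm_inv_designMatrix_le hlam0 x t (x t)
      have h2 : ‖x t‖ / √lam ≤ ‖x t‖ :=
        div_le_self (norm_nonneg _) (Real.one_le_sqrt.2 hlam)
      exact (pow_le_pow_left₀ (weightedNorm_nonneg _ _) (h1.trans h2) 2).trans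
        (hx t (Nat.lt_succ_self t))
    rw [Finset.sum_range_succ, detRatio_succ hlam0,
      Real.log_mul (by linarith [one_le_detRatio hlam0 x t]) (by positivity), mul_add]
    exact add_le_add (ih fun s hs => hx s (hs.trans (Nat.lt_succ_self t)))
      (le_two_mul_log_one_add hc hq hqc)

end Design

/-! ### Deterministic bounds along one run: estimation error, noise excess and optimism. -/

section Pathwise

variable {d : ℕ} {lam : ℝ} {x : ℕ → Vec d}

/-- The noise accumulated along the arms, `∑_{s < t} e_s x_s`. -/
def noiseSum (x : ℕ → Vec d) (e : ℕ → ℝ) (t : ℕ) : Vec d := ∑ s ∈ Finset.range t, e s • x s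

/-- The mixture likelihood ratio `exp (‖∑_{s < t} e_s x_s‖²_{V_t⁻¹} / 2) / √(det V_t / det (λ I))`
of the self-normalized process. -/
def mixtureLikelihood (lam : ℝ) (x : ℕ → Vec d) (e : ℕ → ℝ) (t : ℕ) : ℝ :=
  Real.exp (weightedNorm (designMatrix lam x t)⁻¹ (noiseSum x e t) ^ 2 / 2) / √(detRatio lam x t)

theorem mixtureLikelihood_zero (hlam : 0 < lam) (x : ℕ → Vec d) (e : ℕ → ℝ) :
    mixtureLikelihood lam x e 0 = 1 := by
  simp [mixtureLikelihood, detRatio_zero hlam, noiseSum, weightedNorm]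

theorem mixtureLikelihood_nonneg (lam : ℝ) (x : ℕ → Vec d) (e : ℕ → ℝ) (t : ℕ) :
    0 ≤ mixtureLikelihood lam x e t := by
  unfold mixtureLikelihood; positivity

/-- The new factor depends on the past only through the scalars `x_tᵀ V_t⁻¹ S_t` and
`‖x_t‖²_{V_t⁻¹}`, with `S_t` the noise sum. A one-dimensional Gaussian mixture therefore suffices to
integrate it. -/
theorem mixtureLikelihood_succ (hlam : 0 < lam) (x : ℕ → Vec d) (e : ℕ → ℝ) (t : ℕ) :
    mixtureLikelihood lam x e (t + 1) = mixtureLikelihood lam x e t *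
      (Real.exp ((e t ^ 2 * weightedNorm (designMatrix lam x t)⁻¹ (x t) ^ 2 +
        2 * e t * ((x t).ofLp ⬝ᵥ (designMatrix lam x t)⁻¹.mulVec (noiseSum x e t).ofLp) -
        ((x t).ofLp ⬝ᵥ (designMatrix lam x t)⁻¹.mulVec (noiseSum x e t).ofLp) ^ 2) /
        (2 * (1 + weightedNorm (designMatrix lam x t)⁻¹ (x t) ^ 2))) /
        √(1 + weightedNorm (designMatrix lam x t)⁻¹ (x t) ^ 2)) := by
  have hA := posDef_designMatrix hlam x t
  have h1 : weightedNorm (designMatrix lam x (t + 1))⁻¹ (noiseSum x e (t + 1)) ^ 2 =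
      weightedNorm (designMatrix lam x t)⁻¹ (noiseSum x e t) ^ 2 +
      (e t ^ 2 * weightedNorm (designMatrix lam x t)⁻¹ (x t) ^ 2 +
        2 * e t * ((x t).ofLp ⬝ᵥ (designMatrix lam x t)⁻¹.mulVec (noiseSum x e t).ofLp) -
        ((x t).ofLp ⬝ᵥ (designMatrix lam x t)⁻¹.mulVec (noiseSum x e t).ofLp) ^ 2) /
        (1 + weightedNorm (designMatrix lam x t)⁻¹ (x t) ^ 2) := by
    rw [sq_weightedNorm (posDef_designMatrix hlam x (t + 1)).inv.posSemidef,
      sq_weightedNorm hA.inv.posSemidef, sq_weightedNorm hA.inv.posSemidef, designMatrix_succ,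
      ← quadForm_inv_add_vecMulVec hA]
    simp [noiseSum, Finset.sum_range_succ]
  rw [mixtureLikelihood, mixtureLikelihood, h1, detRatio_succ hlam,
    Real.sqrt_mul (by linarith [one_le_detRatio hlam x t]), add_div, Real.exp_add, div_div,
    mul_comm _ (2 : ℝ), mul_div_mul_comm]

theorem designMatrix_mulVec (lam : ℝ) (x : ℕ → Vec d) (t : ℕ) (v : Vec d) :
    (designMatrix lam x t).mulVec v.ofLp =
      lam • v.ofLp + ∑ s ∈ Finset.range t, (inner ℝ (x s) v : ℝ) • (x s).ofLp := by
  induction t with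
  | zero => simp [designMatrix_zero, Matrix.smul_mulVec]
  | succ t ih =>
    rw [designMatrix_succ, Matrix.add_mulVec, ih, Finset.sum_range_succ, Matrix.vecMulVec_mulVec,
      inner_eq_dotProduct, add_assoc]
    simp

/-- Centred rewards are `η_s + ⟨x_s, w - h⟩`, and `∑ x_s x_sᵀ = V - lam I`; hence `ŵ - w = V⁻¹ (∑
η_s x_s + lam (h - w))`. -/
theorem inner_biasedEstimate_sub (hlam : 0 < lam) (h w z : Vec d) (x : ℕ → Vec d) (η : ℕ → ℝ)
    (t : ℕ) :
    inner ℝ z (biasedEstimate lam h x (fun s => inner ℝ (x s) w + η s) t - w) =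
      z.ofLp ⬝ᵥ (designMatrix lam x t)⁻¹.mulVec (noiseSum x η t).ofLp +
        lam * (z.ofLp ⬝ᵥ (designMatrix lam x t)⁻¹.mulVec (h - w).ofLp) := by
  have hA := posDef_designMatrix hlam x t
  have hu := (Matrix.isUnit_iff_isUnit_det _).1 hA.isUnit
  have h1 : (∑ s ∈ Finset.range t, (inner ℝ (x s) w + η s - inner ℝ (x s) h) • x s).ofLp =
      (noiseSum x η t).ofLp + lam • (h - w).ofLp -
        (designMatrix lam x t).mulVec (h - w).ofLp := by
    rw [designMatrix_mulVec]
    simp only [noiseSum, inner_sub_right, WithLp.ofLp_sum, WithLp.ofLp_smul, WithLp.ofLp_sub]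
    rw [← sub_sub, add_sub_cancel_right, ← Finset.sum_sub_distrib]
    refine Finset.sum_congr rfl fun s _ => ?_
    module
  rw [inner_eq_dotProduct, biasedEstimate, h1]
  simp only [Matrix.mulVec_add, Matrix.mulVec_sub, Matrix.mulVec_smul, Matrix.mulVec_mulVec,
    Matrix.nonsing_inv_mul _ hu, Matrix.one_mulVec, WithLp.ofLp_add, WithLp.ofLp_sub,
    dotProduct_add, dotProduct_sub, dotProduct_smul, smul_eq_mul]
  ring

theorem abs_inner_biasedEstimate_sub_le (hlam : 0 < lam) (h w z : Vec d) (x : ℕ → Vec d)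
    (η : ℕ → ℝ) (t : ℕ) :
    |inner ℝ z (biasedEstimate lam h x (fun s => inner ℝ (x s) w + η s) t - w)| ≤
      weightedNorm (designMatrix lam x t)⁻¹ z *
        (√lam * ‖h - w‖ + weightedNorm (designMatrix lam x t)⁻¹ (noiseSum x η t)) := by
  have hA := (posDef_designMatrix hlam x t).inv.posSemidef
  rw [inner_biasedEstimate_sub hlam]
  refine (abs_add_le _ _).trans ?_
  have h1 := abs_dotProduct_mulVec_le hA z (noiseSum x η t)
  have h2 := abs_dotProduct_mulVec_le hA z (h - w)
  have h3 := weightedNorm_inv_designMatrix_le hlam x t (h - w)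
  have h4 : lam * (‖h - w‖ / √lam) = √lam * ‖h - w‖ := by
    have hs := Real.sqrt_pos.2 hlam
    nth_rewrite 1 [← Real.mul_self_sqrt hlam.le]
    field_simp
  rw [abs_mul, abs_of_pos hlam, mul_add, add_comm]
  refine add_le_add ?_ h1
  rw [← h4]
  calc _ ≤ lam * (weightedNorm (designMatrix lam x t)⁻¹ z * (‖h - w‖ / √lam)) := by
        gcongr
        exact h2.trans (mul_le_mul_of_nonneg_left h3 (weightedNorm_nonneg _ _))
    _ = _ := by ring

theorem confidenceRadius_eq (hlam : 0 < lam) (R : ℝ) {T : ℕ} (hT : 0 < T) (h w : Vec d)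
    (x : ℕ → Vec d) (t : ℕ) :
    confidenceRadius lam R (1 / (T : ℝ)) h w x t =
      √lam * ‖h - w‖ + R * √(2 * Real.log T + Real.log (detRatio lam x t)) := by
  have hT' : (0 : ℝ) < T := Nat.cast_pos.2 hT
  have hr := one_le_detRatio hlam x t
  have h1 : √(designMatrix lam x t).det /
    (√(lam • (1 : Matrix (Fin d) (Fin d) ℝ)).det * (1 / (T : ℝ))) = √(detRatio lam x t) * T := by
    rw [detRatio, Real.sqrt_div (posDef_designMatrix hlam x t).det_pos.le]
    field_simp
  rw [confidenceRadius, h1, Real.log_mul (by positivity) hT'.ne', Real.log_sqrt (by linarith)]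
  congr 3
  ring

/-- For `s = b - a ≥ 0`, `exp u ≥ 1 + u` reduces the claim to `1 + s² / 2 + a s - s ≥ 0`, which
holds as `a ≥ 0`. -/
theorem sub_le_exp_half_sq_sub {a b : ℝ} (ha : 0 ≤ a) :
    b - a ≤ Real.exp ((b ^ 2 - a ^ 2) / 2) := by
  rcases le_total b a with hb | hb
  · linarith [Real.exp_pos ((b ^ 2 - a ^ 2) / 2)]
  · have h1 := Real.add_one_le_exp ((b ^ 2 - a ^ 2) / 2)
    nlinarith [sq_nonneg (b - a - 1), mul_nonneg ha (sub_nonneg.2 hb)]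

/-- Halving the square of the radius gives `log T + log √detRatio`, so the exponential bound is
exactly `M_t / T`. Round `0` has no accumulated noise and contributes `0`; without this saving the
case `T = 1` would fail later. -/
theorem weightedNorm_noiseSum_sub_le (hlam : 0 < lam) {T : ℕ} (hT : 0 < T) (x : ℕ → Vec d)
    (e : ℕ → ℝ) (t : ℕ) :
    weightedNorm (designMatrix lam x t)⁻¹ (noiseSum x e t) -
      √(2 * Real.log T + Real.log (detRatio lam x t)) ≤
      if t = 0 then 0 else mixtureLikelihood lam x e t / T := by
  have hT' : (0 : ℝ) < T := Nat.cast_pos.2 hT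
  have hr := one_le_detRatio hlam x t
  split_ifs with ht
  · subst ht
    simp [noiseSum, weightedNorm]
  · refine (sub_le_exp_half_sq_sub (Real.sqrt_nonneg _)).trans_eq ?_
    have hlT : 0 ≤ Real.log T := Real.log_natCast_nonneg T
    have hlr := Real.log_nonneg hr
    rw [Real.sq_sqrt (by positivity), sub_div, Real.exp_sub, mixtureLikelihood, div_div]
    congr 1
    rw [add_div, Real.exp_add, mul_div_cancel_left₀ _ two_ne_zero, Real.exp_log hT', mul_comm,
      ← Real.log_sqrt (by linarith), Real.exp_log (by positivity)]

theorem noiseSum_smul (x : ℕ → Vec d) (R : ℝ) {η e : ℕ → ℝ} {t : ℕ} (he : ∀ s < t, η s = R * e s) :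
    noiseSum x η t = R • noiseSum x e t := by
  rw [noiseSum, noiseSum, Finset.smul_sum]
  refine Finset.sum_congr rfl fun s hs => ?_
  rw [he s (Finset.mem_range.1 hs), mul_smul]

theorem weightedNorm_smul (A : Matrix (Fin d) (Fin d) ℝ) {R : ℝ} (hR : 0 ≤ R) (z : Vec d) :
    weightedNorm A (R • z) = R * weightedNorm A z := by
  simp only [weightedNorm, WithLp.ofLp_smul, Matrix.mulVec_smul, smul_dotProduct, dotProduct_smul,
    smul_eq_mul]
  rw [← mul_assoc, Real.sqrt_mul (mul_nonneg hR hR), Real.sqrt_mul_self hR]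

/-- The regret of one round: the optimistic choice pays twice the confidence width, plus a term
that is positive only when the confidence set misses the task. -/
theorem inner_sub_le_of_isMaxOn (hlam : 0 < lam) {R L : ℝ} (hR : 0 ≤ R) {T : ℕ} (hT : 0 < T)
    (h w z : Vec d) (x : ℕ → Vec d) {η e : ℕ → ℝ} {t : ℕ} (he : ∀ s < t, η s = R * e s)
    {D : Set (Vec d)} (hz : z ∈ D) (hzL : ‖z‖ ≤ L) (hxL : ‖x t‖ ≤ L)
    (hmax : IsMaxOn (optimisticIndex lam R (1 / (T : ℝ)) h w x
      (fun s => inner ℝ (x s) w + η s) t) D (x t)) :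
    inner ℝ (z - x t) w ≤
      2 * confidenceRadius lam R (1 / (T : ℝ)) h w x t *
        weightedNorm (designMatrix lam x t)⁻¹ (x t) +
      2 * (L / √lam) * (R * if t = 0 then 0 else mixtureLikelihood lam x e t / T) := by
  have hidx := hmax hz
  simp only [Set.mem_ofPred_eq, optimisticIndex] at hidx
  have h1 := abs_le.1 (abs_inner_biasedEstimate_sub_le hlam h w z x η t)
  have h2 := abs_le.1 (abs_inner_biasedEstimate_sub_le hlam h w (x t) x η t)
  have h3 := weightedNorm_noiseSum_sub_le hlam hT x e t
  have hz1 := (weightedNorm_inv_designMatrix_le hlam x t z).trans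
    (div_le_div_of_nonneg_right hzL (Real.sqrt_nonneg lam))
  have hx1 := (weightedNorm_inv_designMatrix_le hlam x t (x t)).trans
    (div_le_div_of_nonneg_right hxL (Real.sqrt_nonneg lam))
  rw [noiseSum_smul x R he, weightedNorm_smul _ hR] at h1 h2
  have hm : 0 ≤ if t = 0 then 0 else mixtureLikelihood lam x e t / T := by
    split_ifs
    · exact le_rfl
    · exact div_nonneg (mixtureLikelihood_nonneg _ _ _ _) (Nat.cast_nonneg T)
  rw [inner_sub_left]
  rw [inner_sub_right] at h1 h2
  rw [confidenceRadius_eq hlam R hT] at hidx ⊢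
  set b := biasedEstimate lam h x (fun s => inner ℝ (x s) w + η s) t
  have hz0 := weightedNorm_nonneg (designMatrix lam x t)⁻¹ z
  have hx0 := weightedNorm_nonneg (designMatrix lam x t)⁻¹ (x t)
  set nz := weightedNorm (designMatrix lam x t)⁻¹ z
  set nx := weightedNorm (designMatrix lam x t)⁻¹ (x t)
  set N := weightedNorm (designMatrix lam x t)⁻¹ (noiseSum x e t)
  set a := √(2 * Real.log T + Real.log (detRatio lam x t))
  set k := if t = 0 then 0 else mixtureLikelihood lam x e t / T
  have h4 : R * N - R * a ≤ R * k := by rw [← mul_sub]; gcongr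
  have hk : 0 ≤ R * k := mul_nonneg hR hm
  have h5 : (nz + nx) * (R * N - R * a) ≤ (2 * (L / √lam)) * (R * k) :=
    (mul_le_mul_of_nonneg_left h4 (add_nonneg hz0 hx0)).trans
      (mul_le_mul_of_nonneg_right (by linarith) hk)
  -- Optimism: add the error bounds for `z` and `x t` to the index inequality. The `z`-widths cancel
  -- up to the excess, leaving twice the width of `x t` plus `h5`.
  nlinarith [h1.1, h2.2]

end Pathwise

/-! ### Conversion of the pathwise sums into the stated rate. -/

section Rates

/-- Bernoulli's inequality. It trades the `L ^ 2` of the determinant bound for the `L` of the stated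
logarithm, at the price of a factor `max 1 L`. -/
theorem log_one_add_mul_le {m u : ℝ} (hm : 1 ≤ m) (hu : 0 ≤ u) :
    Real.log (1 + m * u) ≤ m * Real.log (1 + u) := by
  rw [← Real.log_rpow (by linarith)]
  refine Real.log_le_log (by positivity) ?_
  exact one_add_mul_self_le_rpow_one_add (by linarith) hm

theorem log_add_eq {T : ℕ} (hT : 0 < T) {L c : ℝ} (hL : 0 ≤ L) (hc : 0 ≤ c) :
    Real.log (T + T ^ 2 * L / c) = Real.log T + Real.log (1 + T * L / c) := by
  have hT' : (0 : ℝ) < T := Nat.cast_pos.2 hT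
  rw [← Real.log_mul hT'.ne' (by positivity)]
  congr 1
  ring

variable {d T : ℕ} {lam L : ℝ}

theorem log_detRatio_le (hd : 0 < d) (hlam : 0 < lam) (hL : 0 ≤ L) {x : ℕ → Vec d}
    (hx : ∀ s < T, ‖x s‖ ≤ L) :
    Real.log (detRatio lam x T) ≤ d * (max 1 L * Real.log (1 + T * L / (lam * d))) := by
  have hd' : (0 : ℝ) < d := Nat.cast_pos.2 hd
  have h1 := Real.log_le_log (by linarith [one_le_detRatio hlam x T])
    (detRatio_le hd hlam hx)
  rw [Real.log_pow] at h1
  refine h1.trans (mul_le_mul_of_nonneg_left ?_ hd'.le)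
  refine le_trans ?_ (log_one_add_mul_le (le_max_left 1 L) (by positivity))
  refine Real.log_le_log (by positivity) ?_
  have : T * L ^ 2 / (lam * d) = L * (T * L / (lam * d)) := by ring
  rw [this]
  gcongr
  exact le_max_right 1 L

/-- The total noise excess is absorbed by the main rate. The factor `(T - 1) / T` matters: for `T =
1` the right side is at most `4 * max 1 L ^ 2 * L / lam`, which cannot dominate `2 * L / √lam` for
large `lam`. -/
theorem div_sqrt_mul_le (hd : 0 < d) (hT : 0 < T) (hlam : 1 ≤ lam) (hL : 0 ≤ L) :
    2 * (L / √lam) * ((T - 1) / T) ≤ max 1 L ^ 2 * (4 * d *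
      √(T * Real.log (T + T ^ 2 * L / (lam * d)) * Real.log (1 + T * L / (lam * d)))) := by
  have hd1 : (1 : ℝ) ≤ d := Nat.one_le_cast.2 hd
  have hm : 1 ≤ max 1 L := le_max_left 1 L
  have hLm : L ≤ max 1 L := le_max_right 1 L
  rcases (Nat.one_le_iff_ne_zero.2 hT.ne').eq_or_lt with h1 | h2
  · rw [← h1]
    simp only [Nat.cast_one, sub_self, zero_div, mul_zero]
    positivity
  · have hT2 : (2 : ℝ) ≤ T := by exact_mod_cast h2
    have hlam0 : 0 < lam := by linarith
    have hu : 0 ≤ T * L / (lam * d) := by positivity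
    rw [log_add_eq hT hL (by positivity)]
    have hl2 : (1 : ℝ) / 2 ≤ Real.log 2 := by linarith [Real.log_two_gt_d9]
    have hlT : 1 / 2 ≤ Real.log T := hl2.trans (Real.log_le_log (by norm_num) hT2)
    have hl0 : 0 ≤ Real.log (1 + T * L / (lam * d)) := Real.log_nonneg (by linarith)
    set m := max 1 L
    have hu2 : T * L / (lam * d) ≥ 2 * (L / lam) / d := by
      rw [mul_div_assoc', div_div]; gcongr
    set u := T * L / (lam * d)
    have h3 : (L / √lam) ^ 2 ≤ 2 * m ^ 2 * d * Real.log (1 + u) := by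
      rw [div_pow, Real.sq_sqrt hlam0.le]
      -- For `u ≤ 1` the logarithm is at least `u / 2`, and `T ≥ 2` makes this at least `L / (lam
      -- d)`; for `u ≥ 1` it is at least `log 2 ≥ 1 / 2`.
      rcases le_total u 1 with h1 | h1
      · have h4 := Real.one_sub_inv_le_log_of_pos (show 0 < 1 + u by linarith)
        have h5 : u / 2 ≤ 1 - (1 + u)⁻¹ := by
          have : 1 - (1 + u)⁻¹ = u / (1 + u) := by field_simp; ring
          rw [this]
          gcongr
          linarith
        have h6 : L / lam / d ≤ Real.log (1 + u) := by linarith [mul_div_assoc 2 (L / lam) (d : ℝ)]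
        calc L ^ 2 / lam = L * (L / lam) := by ring
          _ ≤ (2 * m ^ 2) * (L / lam) := by gcongr; nlinarith
          _ = 2 * m ^ 2 * d * (L / lam / d) := by field_simp
          _ ≤ _ := by gcongr
      · have h4 : 1 / 2 ≤ Real.log (1 + u) :=
          hl2.trans (Real.log_le_log (by norm_num) (by linarith))
        calc L ^ 2 / lam ≤ L ^ 2 := div_le_self (sq_nonneg _) hlam
          _ ≤ m ^ 2 := by gcongr
          _ = 2 * m ^ 2 * 1 * (1 / 2) := by ring
          _ ≤ _ := by gcongr
    have hTG : 1 ≤ T * (Real.log T + Real.log (1 + u)) := by nlinarith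
    have h7 : L / √lam ≤ 2 * m ^ 2 * d *
        √(T * (Real.log T + Real.log (1 + u)) * Real.log (1 + u)) := by
      refine (sq_le_sq₀ (by positivity) (by positivity)).1 ?_
      rw [mul_pow, Real.sq_sqrt (by positivity)]
      refine h3.trans ?_
      have hm2 : 1 ≤ m ^ 2 := one_le_pow₀ hm
      calc 2 * m ^ 2 * d * Real.log (1 + u) ≤ 4 * m ^ 2 * d * Real.log (1 + u) := by gcongr; norm_num
        _ = (4 * m ^ 2 * d) * (1 * 1) * (1 * Real.log (1 + u)) := by ring
        _ ≤ (4 * m ^ 2 * d) * (m ^ 2 * d) *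
          (T * (Real.log T + Real.log (1 + u)) * Real.log (1 + u)) := by gcongr
        _ = _ := by ring
    have h8 : ((T : ℝ) - 1) / T ≤ 1 := by rw [div_le_one (by linarith)]; linarith
    calc 2 * (L / √lam) * ((T - 1) / T) ≤ 2 * (L / √lam) * 1 := by gcongr
      _ ≤ 2 * (2 * m ^ 2 * d *
        √(T * (Real.log T + Real.log (1 + u)) * Real.log (1 + u))) := by linarith
      _ = _ := by ring

/-- The confidence widths along the arms add up to the rate of the regret bound. -/
theorem sum_confidenceRadius_mul_le (hd : 0 < d) (hT : 0 < T) (hlam : 1 ≤ lam) (hL : 0 ≤ L)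
    {R : ℝ} (hR : 0 ≤ R) (h w : Vec d) {x : ℕ → Vec d} (hx : ∀ s < T, ‖x s‖ ≤ L) :
    ∑ t ∈ Finset.range T, 2 * confidenceRadius lam R (1 / (T : ℝ)) h w x t *
        weightedNorm (designMatrix lam x t)⁻¹ (x t) ≤
      max 1 L ^ 2 * (4 * √(T * d * lam * Real.log (1 + T * L / (lam * d))) * ‖w - h‖ +
        4 * R * d * √(T * Real.log (T + T ^ 2 * L / (lam * d)) *
          Real.log (1 + T * L / (lam * d)))) := by
  have hd1 : (1 : ℝ) ≤ d := Nat.one_le_cast.2 hd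
  have hlam0 : 0 < lam := by linarith
  have hm : 1 ≤ max 1 L := le_max_left 1 L
  have hLm : L ≤ max 1 L := le_max_right 1 L
  have hratio := log_detRatio_le hd hlam0 hL hx
  have hpot := sum_sq_weightedNorm_le hlam (one_le_pow₀ hm : 1 ≤ max 1 L ^ 2) (t := T) (x := x)
    fun s hs => pow_le_pow_left₀ (norm_nonneg _) ((hx s hs).trans hLm) 2
  have hu : 0 ≤ T * L / (lam * d) := by positivity
  rw [log_add_eq hT hL (by positivity), norm_sub_rev w h]
  have hlT : 0 ≤ Real.log T := Real.log_natCast_nonneg T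
  have hl0 : 0 ≤ Real.log (1 + T * L / (lam * d)) := Real.log_nonneg (by linarith)
  set m := max 1 L
  set l := Real.log (1 + T * L / (lam * d))
  set n := fun t => weightedNorm (designMatrix lam x t)⁻¹ (x t) with hn
  have hn0 : ∀ t, 0 ≤ n t := fun t => weightedNorm_nonneg _ _
  have hbeta : ∀ t < T, confidenceRadius lam R (1 / (T : ℝ)) h w x t ≤
      √lam * ‖h - w‖ + R * √(2 * d * m * (Real.log T + l)) := by
    intro t ht
    rw [confidenceRadius_eq hlam0 R hT]
    gcongr
    have h1 := Real.log_le_log (by linarith [one_le_detRatio hlam0 x t])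
      (detRatio_mono hlam0 x ht.le)
    have hdm : 1 ≤ d * m := one_le_mul_of_one_le_of_one_le hd1 hm
    nlinarith [mul_nonneg (sub_nonneg.2 hdm) hlT, mul_nonneg (by linarith : 0 ≤ d * m) hl0]
  -- Cauchy–Schwarz over the rounds; `m ^ 3` is `m ^ 2` from the potential lemma times `m` from
  -- `log_detRatio_le`.
  have hsum : ∑ t ∈ Finset.range T, n t ≤ √(2 * T * m ^ 3 * d * l) := by
    refine Real.le_sqrt_of_sq_le ((sq_sum_le_card_mul_sum_sq).trans ?_)
    rw [Finset.card_range]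
    calc _ ≤ T * (2 * m ^ 2 * (d * (m * l))) :=
          mul_le_mul_of_nonneg_left (hpot.trans (by gcongr)) (Nat.cast_nonneg T)
      _ = _ := by ring
  set B := √lam * ‖h - w‖ + R * √(2 * d * m * (Real.log T + l)) with hB
  have hfirst : √lam * √(2 * T * m ^ 3 * d * l) ≤ 2 * m ^ 2 * √(T * d * lam * l) := by
    rw [← Real.sqrt_mul hlam0.le]
    refine Real.sqrt_le_iff.2 ⟨by positivity, ?_⟩
    rw [mul_pow, Real.sq_sqrt (by positivity)]
    have : m ^ 3 ≤ m ^ 4 := pow_le_pow_right₀ hm (by norm_num)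
    calc lam * (2 * T * m ^ 3 * d * l) = 2 * m ^ 3 * (T * d * lam * l) := by ring
      _ ≤ 4 * m ^ 4 * (T * d * lam * l) := by gcongr; linarith [pow_pos (zero_lt_one.trans_le hm) 4]
      _ = _ := by ring
  have hsecond : √(2 * d * m * (Real.log T + l)) * √(2 * T * m ^ 3 * d * l) =
      2 * m ^ 2 * d * √(T * (Real.log T + l) * l) := by
    rw [← Real.sqrt_mul (by positivity)]
    rw [show 2 * d * m * (Real.log T + l) * (2 * T * m ^ 3 * d * l) =
      (2 * m ^ 2 * d) ^ 2 * (T * (Real.log T + l) * l) by ring, Real.sqrt_mul (sq_nonneg _),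
      Real.sqrt_sq (by positivity)]
  calc ∑ t ∈ Finset.range T, 2 * confidenceRadius lam R (1 / (T : ℝ)) h w x t * n t
      ≤ ∑ t ∈ Finset.range T, 2 * B * n t := by
        refine Finset.sum_le_sum fun t ht => ?_
        have := hbeta t (Finset.mem_range.1 ht)
        have := hn0 t
        gcongr
    _ = 2 * B * ∑ t ∈ Finset.range T, n t := by rw [Finset.mul_sum]
    _ ≤ 2 * B * √(2 * T * m ^ 3 * d * l) := by gcongr
    _ = 2 * ‖h - w‖ * (√lam * √(2 * T * m ^ 3 * d * l)) + 2 * R *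
        (√(2 * d * m * (Real.log T + l)) * √(2 * T * m ^ 3 * d * l)) := by rw [hB]; ring
    _ ≤ 2 * ‖h - w‖ * (2 * m ^ 2 * √(T * d * lam * l)) + 2 * R *
        (2 * m ^ 2 * d * √(T * (Real.log T + l) * l)) := by
        rw [hsecond]; gcongr
    _ = _ := by ring

end Rates

/-! ### Conditional sub-Gaussianity with random exponents and Gaussian mixtures. -/

section Subgaussian

open scoped ENNReal

variable {Ω : Type*} {m m0 : MeasurableSpace Ω} {μ : Measure Ω}

/-- The hypothesis compares two measures on `m`, so every nonnegative `m`-measurable weight can be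
integrated against them, whether or not it is integrable. -/
theorem lintegral_mul_le_of_setLIntegral_le (hm : m ≤ m0) {f : Ω → ℝ≥0∞} (hf : Measurable f)
    {c : ℝ≥0∞} (h : ∀ A, MeasurableSet[m] A → ∫⁻ ω in A, f ω ∂μ ≤ c * μ A)
    {W : Ω → ℝ≥0∞} (hW : Measurable[m] W) :
    ∫⁻ ω, W ω * f ω ∂μ ≤ c * ∫⁻ ω, W ω ∂μ := by
  have hle : (μ.withDensity f).trim hm ≤ c • μ.trim hm := by
    refine Measure.le_iff.2 fun A hA => ?_
    rw [trim_measurableSet_eq hm hA, withDensity_apply _ (hm A hA), Measure.smul_apply,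
      trim_measurableSet_eq hm hA, smul_eq_mul]
    exact h A hA
  calc ∫⁻ ω, W ω * f ω ∂μ = ∫⁻ ω, W ω ∂(μ.withDensity f) := by
        rw [lintegral_withDensity_eq_lintegral_mul _ hf (hW.mono hm le_rfl)]
        simp [mul_comm]
    _ = ∫⁻ ω, W ω ∂((μ.withDensity f).trim hm) := (lintegral_trim hm hW).symm
    _ ≤ ∫⁻ ω, W ω ∂(c • μ.trim hm) := lintegral_mono' hle le_rfl
    _ = c * ∫⁻ ω, W ω ∂μ := by rw [lintegral_smul_measure, lintegral_trim hm hW, smul_eq_mul]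

theorem CondSubgaussian.lintegral_const_le [IsFiniteMeasure μ] (hm : m ≤ m0) {X : Ω → ℝ} {R : ℝ}
    (hX : Measurable X) (h : CondSubgaussian m X R μ) (s : ℝ) {W : Ω → ℝ≥0∞}
    (hW : Measurable[m] W) :
    ∫⁻ ω, W ω * ENNReal.ofReal (Real.exp (s * X ω - s ^ 2 * R ^ 2 / 2)) ∂μ ≤ ∫⁻ ω, W ω ∂μ := by
  have hset : ∀ A, MeasurableSet[m] A → ∫⁻ ω in A, ENNReal.ofReal (Real.exp (s * X ω)) ∂μ ≤
      ENNReal.ofReal (Real.exp (s ^ 2 * R ^ 2 / 2)) * μ A := by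
    intro A hA
    rw [← ofReal_integral_eq_lintegral_ofReal (h s).1.integrableOn
      (Filter.Eventually.of_forall fun ω => (Real.exp_pos _).le),
      ← setIntegral_condExp hm (h s).1 hA]
    have h1 : ∫ ω in A, (μ[fun ω => Real.exp (s * X ω) | m]) ω ∂μ ≤
        ∫ _ in A, Real.exp (s ^ 2 * R ^ 2 / 2) ∂μ :=
      setIntegral_mono_ae integrable_condExp.integrableOn (integrable_const _).integrableOn (h s).2
    refine (ENNReal.ofReal_le_ofReal h1).trans_eq ?_
    rw [setIntegral_const, smul_eq_mul, mul_comm, ENNReal.ofReal_mul (Real.exp_pos _).le,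
      ofReal_measureReal]
  have hc : ENNReal.ofReal (Real.exp (s ^ 2 * R ^ 2 / 2)) ≠ 0 := by
    simpa using Real.exp_pos _
  calc _ = (ENNReal.ofReal (Real.exp (s ^ 2 * R ^ 2 / 2)))⁻¹ *
        ∫⁻ ω, W ω * ENNReal.ofReal (Real.exp (s * X ω)) ∂μ := by
        rw [← lintegral_const_mul _ (by have := hW.mono hm le_rfl; fun_prop)]
        refine lintegral_congr fun ω => ?_
        rw [Real.exp_sub, ENNReal.ofReal_div_of_pos (Real.exp_pos _), div_eq_mul_inv]
        ring
    _ ≤ (ENNReal.ofReal (Real.exp (s ^ 2 * R ^ 2 / 2)))⁻¹ *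
        (ENNReal.ofReal (Real.exp (s ^ 2 * R ^ 2 / 2)) * ∫⁻ ω, W ω ∂μ) := by
        gcongr
        exact lintegral_mul_le_of_setLIntegral_le hm (by fun_prop) hset hW
    _ = _ := by rw [← mul_assoc, ENNReal.inv_mul_cancel hc ENNReal.ofReal_ne_top, one_mul]

theorem CondSubgaussian.lintegral_le_of_finite_range [IsFiniteMeasure μ] (hm : m ≤ m0)
    {X : Ω → ℝ} {R : ℝ} (hX : Measurable X) (h : CondSubgaussian m X R μ) {s : Ω → ℝ}
    (hs : Measurable[m] s) (hfin : (Set.range s).Finite) {W : Ω → ℝ≥0∞} (hW : Measurable[m] W) :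
    ∫⁻ ω, W ω * ENNReal.ofReal (Real.exp (s ω * X ω - s ω ^ 2 * R ^ 2 / 2)) ∂μ ≤
      ∫⁻ ω, W ω ∂μ := by
  have hdec : ∀ f : ℝ → Ω → ℝ≥0∞, ∀ ω, f (s ω) ω =
      ∑ c ∈ hfin.toFinset, (s ⁻¹' {c}).indicator (f c) ω := by
    intro f ω
    rw [Finset.sum_eq_single (s ω)]
    · simp
    · intro c _ hc
      exact Set.indicator_of_notMem (fun hmem => hc (by simpa using hmem.symm)) _
    · intro hmem
      simp at hmem
  have hms : ∀ c, MeasurableSet[m] (s ⁻¹' {c}) := fun c => hs (measurableSet_singleton c)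
  have hW0 := hW.mono hm le_rfl
  calc _ = ∑ c ∈ hfin.toFinset, ∫⁻ ω, (s ⁻¹' {c}).indicator W ω *
          ENNReal.ofReal (Real.exp (c * X ω - c ^ 2 * R ^ 2 / 2)) ∂μ := by
        rw [← lintegral_finsetSum]
        · refine lintegral_congr fun ω => ?_
          rw [hdec (fun c ω => W ω * ENNReal.ofReal (Real.exp (c * X ω - c ^ 2 * R ^ 2 / 2))) ω]
          refine Finset.sum_congr rfl fun c _ => ?_
          by_cases hc : ω ∈ s ⁻¹' {c}
          · simp only [Set.indicator_of_mem hc]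
          · simp only [Set.indicator_of_notMem hc, zero_mul]
        · intro c _
          have := hW0.indicator (hm _ (hms c))
          fun_prop
    _ ≤ ∑ c ∈ hfin.toFinset, ∫⁻ ω, (s ⁻¹' {c}).indicator W ω ∂μ :=
        Finset.sum_le_sum fun c _ => h.lintegral_const_le hm hX c (hW.indicator (hms c))
    _ = ∫⁻ ω, W ω ∂μ := by
        rw [← lintegral_finsetSum _ fun c _ => hW0.indicator (hm _ (hms c))]
        exact lintegral_congr fun ω => (hdec (fun _ => W) ω).symm

/-- Approximate the exponent by `m`-measurable simple functions and apply Fatou's lemma. -/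
theorem CondSubgaussian.lintegral_le [IsFiniteMeasure μ] (hm : m ≤ m0) {X : Ω → ℝ}
    {R : ℝ} (hX : Measurable X) (h : CondSubgaussian m X R μ) {s : Ω → ℝ} (hs : Measurable[m] s)
    {W : Ω → ℝ≥0∞} (hW : Measurable[m] W) :
    ∫⁻ ω, W ω * ENNReal.ofReal (Real.exp (s ω * X ω - s ω ^ 2 * R ^ 2 / 2)) ∂μ ≤
      ∫⁻ ω, W ω ∂μ := by
  have hss := hs.stronglyMeasurable
  have hW0 := hW.mono hm le_rfl
  set a := fun n => hss.approx n
  have ham : ∀ n, Measurable[m0] (a n) := fun n =>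
    (@SimpleFunc.measurable Ω ℝ m _ (a n)).mono hm le_rfl
  set g : ℝ → Ω → ℝ≥0∞ := fun c ω =>
    W ω * ENNReal.ofReal (Real.exp (c * X ω - c ^ 2 * R ^ 2 / 2))
  have hlim : ∀ ω, Filter.Tendsto (fun n => g (a n ω) ω) Filter.atTop (nhds (g (s ω) ω)) := by
    intro ω
    refine ENNReal.Tendsto.const_mul (ENNReal.tendsto_ofReal ?_) (Or.inl (by simp [Real.exp_pos]))
    have hc : Continuous fun c : ℝ => Real.exp (c * X ω - c ^ 2 * R ^ 2 / 2) := by fun_prop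
    exact (hc.tendsto _).comp (hss.tendsto_approx ω)
  calc ∫⁻ ω, g (s ω) ω ∂μ = ∫⁻ ω, Filter.liminf (fun n => g (a n ω) ω) Filter.atTop ∂μ :=
        lintegral_congr fun ω => (hlim ω).liminf_eq.symm
    _ ≤ Filter.liminf (fun n => ∫⁻ ω, g (a n ω) ω ∂μ) Filter.atTop :=
        lintegral_liminf_le fun n => by
          have := ham n
          simp only [g]
          fun_prop
    _ ≤ Filter.liminf (fun _ : ℕ => ∫⁻ ω, W ω ∂μ) Filter.atTop :=
        Filter.liminf_le_liminf (Filter.Eventually.of_forall fun n =>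
          h.lintegral_le_of_finite_range hm hX
            (@SimpleFunc.measurable Ω ℝ m _ (a n)) (@SimpleFunc.finite_range Ω ℝ m (a n)) hW)
    _ = _ := Filter.liminf_const _

/-- Completing the square turns the integrand into a constant times the Gaussian density of mean `√q
(y - p) / (1 + q)` and variance `1 / (1 + q)`. -/
theorem lintegral_gaussian_exp_mixture (p y : ℝ) {q : ℝ} (hq : 0 ≤ q) :
    ∫⁻ z, ENNReal.ofReal (Real.exp ((p + √q * z) * y - (p + √q * z) ^ 2 * 1 ^ 2 / 2))
      ∂(gaussianReal 0 1) =
    ENNReal.ofReal (Real.exp ((y ^ 2 * q + 2 * y * p - p ^ 2) / (2 * (1 + q))) / √(1 + q)) := by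
  obtain ⟨v, hv⟩ : ∃ v : NNReal, (v : ℝ) = (1 + q)⁻¹ :=
    ⟨Real.toNNReal (1 + q)⁻¹, Real.coe_toNNReal _ (by positivity)⟩
  have hv0 : v ≠ 0 := by
    rintro rfl
    have : 0 < (1 + q)⁻¹ := by positivity
    simp [← hv] at this
  rw [gaussianReal_of_var_ne_zero _ one_ne_zero,
    lintegral_withDensity_eq_lintegral_mul _ (measurable_gaussianPDF _ _) (by fun_prop)]
  rw [← mul_one (ENNReal.ofReal (_ / _)),
    ← lintegral_gaussianPDF_eq_one (√q * (y - p) / (1 + q)) hv0,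
    ← lintegral_const_mul _ (measurable_gaussianPDF _ _)]
  refine lintegral_congr fun z => ?_
  rw [Pi.mul_apply, gaussianPDF, gaussianPDF, ← ENNReal.ofReal_mul (gaussianPDFReal_nonneg _ _ _),
    ← ENNReal.ofReal_mul (by positivity)]
  congr 1
  simp only [gaussianPDFReal, hv, NNReal.coe_one, sub_zero, mul_one]
  have h1 : √(2 * Real.pi * (1 + q)⁻¹) = √(2 * Real.pi) / √(1 + q) := by
    rw [← div_eq_mul_inv, Real.sqrt_div (by positivity)]
  have hs1 : 0 < √(1 + q) := by positivity
  have hs2 : 0 < √(2 * Real.pi) := by positivity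
  have h2 : ∀ a b c e : ℝ, a + b = c + e →
      (√(2 * Real.pi))⁻¹ * Real.exp a * Real.exp b =
      Real.exp c / √(1 + q) * ((√(2 * Real.pi) / √(1 + q))⁻¹ * Real.exp e) := by
    intro a b c e hab
    rw [mul_assoc, ← Real.exp_add, hab, Real.exp_add]
    field_simp
  rw [h1]
  apply h2
  have h3 : √q ^ 2 = q := Real.sq_sqrt hq
  clear h2 h1 hs1 hv
  generalize √q = r at h3
  subst h3
  have h4 : (1 + r ^ 2) ≠ 0 := by positivity
  field_simp
  ring

/-- By Tonelli the mixture variable `z` can be fixed first; then `p + √q z` is an admissible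
`m`-measurable exponent. -/
theorem CondSubgaussian.lintegral_mixture_le [IsFiniteMeasure μ] (hm : m ≤ m0) {X : Ω → ℝ}
    (hX : Measurable X) (h : CondSubgaussian m X 1 μ) {p q : Ω → ℝ} (hp : Measurable[m] p)
    (hq : Measurable[m] q) (hq0 : ∀ ω, 0 ≤ q ω) {W : Ω → ℝ≥0∞} (hW : Measurable[m] W) :
    ∫⁻ ω, W ω * ENNReal.ofReal (Real.exp ((X ω ^ 2 * q ω + 2 * X ω * p ω - p ω ^ 2) /
      (2 * (1 + q ω))) / √(1 + q ω)) ∂μ ≤ ∫⁻ ω, W ω ∂μ := by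
  have hW0 := hW.mono hm le_rfl
  have hp0 := hp.mono hm le_rfl
  have hqm0 := hq.mono hm le_rfl
  calc _ = ∫⁻ ω, ∫⁻ z, W ω * ENNReal.ofReal (Real.exp ((p ω + √(q ω) * z) * X ω -
          (p ω + √(q ω) * z) ^ 2 * 1 ^ 2 / 2)) ∂(gaussianReal 0 1) ∂μ := by
        refine lintegral_congr fun ω => ?_
        rw [lintegral_const_mul _ (by fun_prop), lintegral_gaussian_exp_mixture _ _ (hq0 ω)]
    _ = ∫⁻ z, ∫⁻ ω, W ω * ENNReal.ofReal (Real.exp ((p ω + √(q ω) * z) * X ω -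
          (p ω + √(q ω) * z) ^ 2 * 1 ^ 2 / 2)) ∂μ ∂(gaussianReal 0 1) :=
        lintegral_lintegral_swap (by unfold Function.uncurry; fun_prop)
    _ ≤ ∫⁻ _, ∫⁻ ω, W ω ∂μ ∂(gaussianReal 0 1) :=
        lintegral_mono fun z => h.lintegral_le hm hX (by fun_prop) hW
    _ = _ := by simp

theorem CondSubgaussian.div {X : Ω → ℝ} {R : ℝ} (hR : 0 < R) (h : CondSubgaussian m X R μ) :
    CondSubgaussian m (fun ω => X ω / R) 1 μ := by
  intro s
  have h1 := h (s / R)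
  have h2 : (s / R) ^ 2 * R ^ 2 / 2 = s ^ 2 * 1 ^ 2 / 2 := by field_simp
  have h3 : (fun ω => Real.exp (s / R * X ω)) = fun ω => Real.exp (s * (X ω / R)) := by
    ext ω; congr 1; ring
  rwa [h2, h3] at h1

/-- The nonnegative variable `exp X + exp (-X) - 2` has mean at most `0`, and it vanishes only where
`X = 0`. -/
theorem CondSubgaussian.ae_eq_zero [IsProbabilityMeasure μ] (hm : m ≤ m0) {X : Ω → ℝ}
    (h : CondSubgaussian m X 0 μ) : ∀ᵐ ω ∂μ, X ω = 0 := by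
  have hint : ∀ s : ℝ, ∫ ω, Real.exp (s * X ω) ∂μ ≤ 1 := fun s => by
    rw [← integral_condExp hm]
    calc _ ≤ ∫ _, Real.exp (s ^ 2 * 0 ^ 2 / 2) ∂μ :=
          integral_mono_ae integrable_condExp (integrable_const _) (h s).2
      _ = 1 := by simp
  have h1 := hint 1
  have h2 := hint (-1)
  have hpos : ∀ a : ℝ, 0 ≤ Real.exp (1 * a) + Real.exp (-1 * a) - 2 := fun a => by
    have := Real.one_le_cosh a
    rw [Real.cosh_eq] at this
    simp only [one_mul, neg_mul]
    linarith
  have hi := ((h 1).1.add (h (-1)).1).sub (integrable_const (2 : ℝ))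
  have hz : ∫ ω, (Real.exp (1 * X ω) + Real.exp (-1 * X ω) - 2) ∂μ = 0 := by
    refine le_antisymm ?_ (integral_nonneg fun ω => hpos _)
    have : ∫ ω, (Real.exp (1 * X ω) + Real.exp (-1 * X ω) - 2) ∂μ =
        ∫ ω, Real.exp (1 * X ω) ∂μ + ∫ ω, Real.exp (-1 * X ω) ∂μ - 2 := by
      rw [integral_sub (by exact (h 1).1.add (h (-1)).1) (integrable_const _),
        integral_add (h 1).1 (h (-1)).1]
      simp
    linarith
  filter_upwards [(integral_eq_zero_iff_of_nonneg (fun ω => hpos (X ω)) hi).1 hz] with ω hω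
  by_contra hne
  have := Real.one_lt_cosh.2 hne
  rw [Real.cosh_eq] at this
  simp only [one_mul, neg_mul, Pi.zero_apply] at hω
  linarith

end Subgaussian

/-! ### Measurability of the matrix quantities, for an arbitrary σ-algebra. -/

section Measurability

variable {Ω : Type*} [MeasurableSpace Ω] {n : Type*} [Fintype n]

theorem measurable_dotProduct {u v : Ω → n → ℝ} (hu : ∀ i, Measurable fun ω => u ω i)
    (hv : ∀ i, Measurable fun ω => v ω i) : Measurable fun ω => u ω ⬝ᵥ v ω :=
  Finset.measurable_sum _ fun i _ => (hu i).mul (hv i)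

variable [DecidableEq n]

theorem measurable_det {A : Ω → Matrix n n ℝ} (hA : ∀ i j, Measurable fun ω => A ω i j) :
    Measurable fun ω => (A ω).det := by
  simp only [Matrix.det_apply]
  exact Finset.measurable_sum _ fun σ _ =>
    (Finset.measurable_prod _ fun i _ => hA (σ i) i).const_smul _

theorem measurable_inv_apply {A : Ω → Matrix n n ℝ} (hA : ∀ i j, Measurable fun ω => A ω i j)
    (i j : n) : Measurable fun ω => (A ω)⁻¹ i j := by
  simp only [Matrix.inv_def, Ring.inverse_eq_inv', Matrix.smul_apply, smul_eq_mul,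
    Matrix.adjugate_apply]
  refine (measurable_det hA).inv.mul (measurable_det fun k l => ?_)
  simp only [Matrix.updateRow_apply]
  split_ifs
  · exact measurable_const
  · exact hA k l

variable {d : ℕ} {lam : ℝ} {x : ℕ → Ω → Vec d} {t : ℕ}

theorem measurable_designMatrix (hx : ∀ s < t, Measurable (x s)) (i j : Fin d) :
    Measurable fun ω => designMatrix lam (fun s => x s ω) t i j := by
  simp only [designMatrix, Matrix.add_apply, Matrix.sum_apply, Matrix.vecMulVec_apply]
  refine measurable_const.add (Finset.measurable_sum _ fun s hs => ?_)
  have := hx s (Finset.mem_range.1 hs)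
  fun_prop

theorem measurable_dotProduct_inv_designMatrix (hx : ∀ s < t, Measurable (x s)) {u v : Ω → Vec d}
    (hu : Measurable u) (hv : Measurable v) :
    Measurable fun ω =>
      (u ω).ofLp ⬝ᵥ (designMatrix lam (fun s => x s ω) t)⁻¹.mulVec (v ω).ofLp :=
  measurable_dotProduct (fun i => by fun_prop) fun i =>
    measurable_dotProduct (fun j => measurable_inv_apply (measurable_designMatrix hx) i j)
      fun j => by fun_prop

theorem measurable_weightedNorm_inv_designMatrix (hx : ∀ s < t, Measurable (x s)) {u : Ω → Vec d}
    (hu : Measurable u) :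
    Measurable fun ω => weightedNorm (designMatrix lam (fun s => x s ω) t)⁻¹ (u ω) :=
  (measurable_dotProduct_inv_designMatrix hx hu hu).sqrt

theorem measurable_noiseSum (hx : ∀ s < t, Measurable (x s)) {e : ℕ → Ω → ℝ}
    (he : ∀ s < t, Measurable (e s)) :
    Measurable fun ω => noiseSum (fun s => x s ω) (fun s => e s ω) t :=
  Finset.measurable_sum _ fun s hs =>
    (he s (Finset.mem_range.1 hs)).smul (hx s (Finset.mem_range.1 hs))

theorem measurable_mixtureLikelihood (hx : ∀ s < t, Measurable (x s)) {e : ℕ → Ω → ℝ}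
    (he : ∀ s < t, Measurable (e s)) :
    Measurable fun ω => mixtureLikelihood lam (fun s => x s ω) (fun s => e s ω) t := by
  have h1 := measurable_weightedNorm_inv_designMatrix (lam := lam) hx (measurable_noiseSum hx he)
  have h2 := measurable_det (measurable_designMatrix (lam := lam) hx)
  unfold mixtureLikelihood detRatio
  fun_prop

end Measurability

/-- The pathwise regret bound, with a remainder that has mean of order `R`. -/
theorem pseudoRegret_le {d T : ℕ} (hd : 0 < d) (hT : 0 < T) {lam R L : ℝ} (hlam : 1 ≤ lam)
    (hR : 0 ≤ R) (hL : 0 ≤ L) (h w : Vec d) {x xstar : ℕ → Vec d} {η e : ℕ → ℝ}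
    {D : ℕ → Set (Vec d)} (he : ∀ t < T, η t = R * e t) (hx : ∀ t < T, ‖x t‖ ≤ L)
    (hxs : ∀ t < T, ‖xstar t‖ ≤ L) (hrun : IsRun T lam R h w D η x)
    (hstar : ∀ t < T, xstar t ∈ D t) :
    pseudoRegret T w xstar x ≤
      max 1 L ^ 2 * (4 * √(T * d * lam * Real.log (1 + T * L / (lam * d))) * ‖w - h‖ +
        4 * R * d * √(T * Real.log (T + T ^ 2 * L / (lam * d)) *
          Real.log (1 + T * L / (lam * d)))) +
        2 * (L / √lam) * (R * ∑ t ∈ Finset.range T,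
          if t = 0 then 0 else mixtureLikelihood lam x e t / T) := by
  refine le_trans ?_ (add_le_add (sum_confidenceRadius_mul_le hd hT hlam hL hR h w hx) le_rfl)
  rw [pseudoRegret, Finset.mul_sum, Finset.mul_sum, ← Finset.sum_add_distrib]
  refine Finset.sum_le_sum fun t ht => ?_
  have ht := Finset.mem_range.1 ht
  exact inner_sub_le_of_isMaxOn (by linarith) hR hT h w (xstar t) x
    (fun s hs => he s (hs.trans ht)) (hstar t ht) (hxs t ht) (hx t ht) (hrun t ht).2

/-! ### The mean of the mixture likelihood ratio and the expected regret on one task. -/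

section SelfNormalized

open scoped ENNReal

variable {Ω : Type*} {mΩ : MeasurableSpace Ω} {μ : Measure Ω} [IsProbabilityMeasure μ]
  {𝓕 : Filtration ℕ mΩ} {d T : ℕ} {lam : ℝ} {x : ℕ → Ω → Vec d}

/-- The mixture likelihood ratio of `1`-sub-Gaussian noise has mean at most one. -/
theorem lintegral_mixtureLikelihood_le (hlam : 0 < lam) {e : ℕ → Ω → ℝ}
    (hx : ∀ t < T, Measurable[𝓕 t] (x t)) (he : ∀ t < T, Measurable[𝓕 (t + 1)] (e t))
    (hsub : ∀ t < T, CondSubgaussian (𝓕 t) (e t) 1 μ) {t : ℕ} (ht : t ≤ T) :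
    ∫⁻ ω, ENNReal.ofReal (mixtureLikelihood lam (fun s => x s ω) (fun s => e s ω) t) ∂μ ≤ 1 := by
  induction t with
  | zero => simp [mixtureLikelihood_zero hlam]
  | succ t ih =>
    have htT : t < T := ht
    have hxt : ∀ s < t, Measurable[𝓕 t] (x s) := fun s hs =>
      (hx s (hs.trans htT)).mono (𝓕.mono hs.le) le_rfl
    have het : ∀ s < t, Measurable[𝓕 t] (e s) := fun s hs =>
      (he s (hs.trans htT)).mono (𝓕.mono hs) le_rfl
    -- Measurability is needed for `𝓕 t`, not just for the ambient σ-algebra: these quantities are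
    -- the weight and the mixture parameters known before `e t`.
    have hM := @measurable_mixtureLikelihood Ω (𝓕 t) d lam x t hxt e het
    have hp := @measurable_dotProduct_inv_designMatrix Ω (𝓕 t) d lam x t hxt _ _ (hx t htT)
      (@measurable_noiseSum Ω (𝓕 t) d x t hxt e het)
    have hq := @measurable_weightedNorm_inv_designMatrix Ω (𝓕 t) d lam x t hxt _ (hx t htT)
    refine le_trans ?_ (ih htT.le)
    simp only [mixtureLikelihood_succ hlam, ENNReal.ofReal_mul (mixtureLikelihood_nonneg _ _ _ _)]
    exact (hsub t htT).lintegral_mixture_le (𝓕.le t) ((he t htT).mono (𝓕.le _) le_rfl) hp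
      (hq.pow_const 2) (fun ω => sq_nonneg _) hM.ennreal_ofReal

/-- Normalizes the noise to scale one: `e = η / R` for `R > 0`, and `e = 0` for `R = 0`, where `η`
vanishes almost surely. -/
theorem exists_eq_mul_and_integrable_mixtureLikelihood (hlam : 0 < lam) {R : ℝ} (hR : 0 ≤ R)
    {η : ℕ → Ω → ℝ} (hx : ∀ t < T, Measurable[𝓕 t] (x t))
    (hη : ∀ t < T, Measurable[𝓕 (t + 1)] (η t))
    (hsub : ∀ t < T, CondSubgaussian (𝓕 t) (η t) R μ) :
    ∃ e : ℕ → Ω → ℝ, (∀ᵐ ω ∂μ, ∀ t < T, η t ω = R * e t ω) ∧ ∀ t ≤ T,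
      Integrable (fun ω => mixtureLikelihood lam (fun s => x s ω) (fun s => e s ω) t) μ ∧
      ∫ ω, mixtureLikelihood lam (fun s => x s ω) (fun s => e s ω) t ∂μ ≤ 1 := by
  have key : ∀ e : ℕ → Ω → ℝ, (∀ t < T, Measurable[𝓕 (t + 1)] (e t)) →
      (∀ t < T, CondSubgaussian (𝓕 t) (e t) 1 μ) → ∀ t ≤ T,
      Integrable (fun ω => mixtureLikelihood lam (fun s => x s ω) (fun s => e s ω) t) μ ∧
      ∫ ω, mixtureLikelihood lam (fun s => x s ω) (fun s => e s ω) t ∂μ ≤ 1 := by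
    intro e he hs t ht
    have h1 := lintegral_mixtureLikelihood_le hlam hx he hs ht
    have hm : Measurable fun ω => mixtureLikelihood lam (fun s => x s ω) (fun s => e s ω) t :=
      measurable_mixtureLikelihood
        (fun s hst => (hx s (hst.trans_le ht)).mono (𝓕.le _) le_rfl)
        (fun s hst => (he s (hst.trans_le ht)).mono (𝓕.le _) le_rfl)
    have hnn : 0 ≤ᵐ[μ] fun ω => mixtureLikelihood lam (fun s => x s ω) (fun s => e s ω) t :=
      Filter.Eventually.of_forall fun ω => mixtureLikelihood_nonneg _ _ _ _
    refine ⟨⟨hm.aestronglyMeasurable, ?_⟩, ?_⟩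
    · rw [hasFiniteIntegral_iff_ofReal hnn]
      exact h1.trans_lt ENNReal.one_lt_top
    · rw [integral_eq_lintegral_of_nonneg_ae hnn hm.aestronglyMeasurable]
      exact ENNReal.toReal_le_of_le_ofReal zero_le_one (by simpa using h1)
  rcases hR.eq_or_lt with rfl | hR
  · refine ⟨fun _ _ => 0, ?_, key _ (fun t _ => measurable_const) fun t ht s => ?_⟩
    · rw [ae_all_iff]
      intro t
      by_cases ht : t < T
      · filter_upwards [(hsub t ht).ae_eq_zero (𝓕.le t)] with ω hω _
        simpa using hω
      · exact Filter.Eventually.of_forall fun ω h => absurd h ht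
    · refine ⟨integrable_const _, ?_⟩
      simp only [mul_zero, Real.exp_zero]
      rw [condExp_const (𝓕.le t)]
      exact Filter.Eventually.of_forall fun ω => Real.one_le_exp (by positivity)
  · refine ⟨fun t ω => η t ω / R, Filter.Eventually.of_forall fun ω t _ => ?_,
      key _ (fun t ht => (hη t ht).div_const R) fun t ht => (hsub t ht).div hR⟩
    field_simp

/-- The expected regret of BIAS-OFUL on one task. -/
theorem integral_pseudoRegret_le (hd : 0 < d) (hT : 0 < T) (hlam : 1 ≤ lam) {R L : ℝ}
    (hR : 0 ≤ R) (hL : 0 ≤ L) (h w : Vec d) {η : ℕ → Ω → ℝ} {xstar : ℕ → Ω → Vec d}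
    {D : ℕ → Ω → Set (Vec d)} (hx : ∀ t < T, Measurable[𝓕 t] (x t))
    (hη : ∀ t < T, Measurable[𝓕 (t + 1)] (η t))
    (hsub : ∀ t < T, CondSubgaussian (𝓕 t) (η t) R μ)
    (hD : ∀ t < T, ∀ ω, ∀ z ∈ D t ω, ‖z‖ ≤ L)
    (hrun : ∀ ω, IsRun T lam R h w (fun t => D t ω) (fun t => η t ω) (fun t => x t ω))
    (hstar : ∀ t < T, ∀ ω, xstar t ω ∈ D t ω)
    (hint : Integrable
      (fun ω => pseudoRegret T w (fun t => xstar t ω) (fun t => x t ω)) μ) :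
    ∫ ω, pseudoRegret T w (fun t => xstar t ω) (fun t => x t ω) ∂μ ≤
      max 1 L ^ 2 * (8 * √(T * d * lam * Real.log (1 + T * L / (lam * d))) * ‖w - h‖ +
        R * 8 * d * √(T * Real.log (T + T ^ 2 * L / (lam * d)) *
          Real.log (1 + T * L / (lam * d)))) := by
  have hlam0 : 0 < lam := by linarith
  have hT0 : (0 : ℝ) < T := Nat.cast_pos.2 hT
  obtain ⟨e, he, hM⟩ := exists_eq_mul_and_integrable_mixtureLikelihood hlam0 hR hx hη hsub
  set A := √(T * d * lam * Real.log (1 + T * L / (lam * d))) with hA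
  set G := √(T * Real.log (T + T ^ 2 * L / (lam * d)) * Real.log (1 + T * L / (lam * d))) with hG
  set M := fun t ω => mixtureLikelihood lam (fun s => x s ω) (fun s => e s ω) t
  set k : ℕ → Ω → ℝ := fun t ω => if t = 0 then 0 else M t ω / T with hk
  have hkint : ∀ t < T, Integrable (k t) μ := fun t ht => by
    by_cases h0 : t = 0
    · simp [hk, h0]
    · simpa [hk, h0] using (hM t ht.le).1.div_const _
  have hkle : ∀ t < T, ∫ ω, k t ω ∂μ ≤ if t = 0 then 0 else (T : ℝ)⁻¹ := fun t ht => by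
    by_cases h0 : t = 0
    · simp [hk, h0]
    · simp only [hk, h0, if_false]
      rw [integral_div, div_eq_mul_inv]
      exact mul_le_of_le_one_left (by positivity) (hM t ht.le).2
  have hksum : ∑ t ∈ Finset.range T, ∫ ω, k t ω ∂μ ≤ (T - 1) / T := by
    refine (Finset.sum_le_sum fun t ht => hkle t (Finset.mem_range.1 ht)).trans_eq ?_
    obtain ⟨n, rfl⟩ := Nat.exists_eq_succ_of_ne_zero hT.ne'
    rw [Finset.sum_range_succ']
    simp [div_eq_mul_inv]
  have hpt : ∀ᵐ ω ∂μ, pseudoRegret T w (fun t => xstar t ω) (fun t => x t ω) ≤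
      max 1 L ^ 2 * (4 * A * ‖w - h‖ + 4 * R * d * G) +
        2 * (L / √lam) * (R * ∑ t ∈ Finset.range T, k t ω) := by
    filter_upwards [he] with ω hω
    have hxL : ∀ t < T, ‖x t ω‖ ≤ L := fun t ht => hD t ht ω _ (hrun ω t ht).1
    exact pseudoRegret_le (e := fun s => e s ω) hd hT hlam hR hL h w hω hxL
      (fun t ht => hD t ht ω _ (hstar t ht ω)) (hrun ω) fun t ht => hstar t ht ω
  have hsint : Integrable (fun ω => ∑ t ∈ Finset.range T, k t ω) μ :=
    integrable_finsetSum _ fun t ht => hkint t (Finset.mem_range.1 ht)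
  have hnum := div_sqrt_mul_le hd hT hlam hL
  rw [← hG] at hnum
  have hA0 : 0 ≤ A := Real.sqrt_nonneg _
  calc _ ≤ ∫ ω, (max 1 L ^ 2 * (4 * A * ‖w - h‖ + 4 * R * d * G) +
        2 * (L / √lam) * (R * ∑ t ∈ Finset.range T, k t ω)) ∂μ :=
        integral_mono_ae hint ((integrable_const _).add ((hsint.const_mul R).const_mul _)) hpt
    _ = max 1 L ^ 2 * (4 * A * ‖w - h‖ + 4 * R * d * G) +
        2 * (L / √lam) * (R * ∑ t ∈ Finset.range T, ∫ ω, k t ω ∂μ) := by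
        rw [integral_add (integrable_const _) ((hsint.const_mul R).const_mul _),
          integral_const, probReal_univ, one_smul, integral_const_mul, integral_const_mul,
          integral_finsetSum _ fun t ht => hkint t (Finset.mem_range.1 ht)]
    _ ≤ max 1 L ^ 2 * (4 * A * ‖w - h‖ + 4 * R * d * G) +
        R * (2 * (L / √lam) * ((T - 1) / T)) := by
        rw [show R * (2 * (L / √lam) * ((T - 1) / T)) = 2 * (L / √lam) * (R * ((T - 1) / T)) by
          ring]
        gcongr
    _ ≤ max 1 L ^ 2 * (4 * A * ‖w - h‖ + 4 * R * d * G) +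
        R * (max 1 L ^ 2 * (4 * d * G)) := by gcongr
    -- The noise constant `8` is `4` from the widths plus `4` from the excess; the bias term needs
    -- only `4` and is then relaxed to `8`.
    _ = max 1 L ^ 2 * (4 * A * ‖w - h‖ + R * 8 * d * G) := by ring
    _ ≤ _ := by gcongr; norm_num

end SelfNormalized

/-! ### Averaging over the task distribution. -/

section Transfer

variable {d : ℕ} {ρ : Measure (Vec d)} [IsProbabilityMeasure ρ] {h : Vec d} {S : ℝ}

theorem integrable_norm_sub_pow (hS : ∀ᵐ w ∂ρ, ‖w‖ ≤ S) (h : Vec d) (n : ℕ) :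
    Integrable (fun w => ‖w - h‖ ^ n) ρ := by
  refine Integrable.of_bound (by fun_prop) ((S + ‖h‖) ^ n) ?_
  filter_upwards [hS] with w hw
  rw [Real.norm_of_nonneg (by positivity)]
  gcongr
  exact (norm_sub_le w h).trans (by gcongr)

theorem taskMar_le_sqrt_taskVar (hS : ∀ᵐ w ∂ρ, ‖w‖ ≤ S) (h : Vec d) :
    taskMar ρ h ≤ √(taskVar ρ h) := by
  refine Real.le_sqrt_of_sq_le ?_
  have h1 : Integrable (fun w => ‖w - h‖) ρ := by simpa using integrable_norm_sub_pow hS h 1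
  have h2 := integrable_norm_sub_pow hS h 2
  have h3 : 0 ≤ ∫ w, (‖w - h‖ - taskMar ρ h) ^ 2 ∂ρ := integral_nonneg fun _ => sq_nonneg _
  have h4 : ∫ w, (‖w - h‖ - taskMar ρ h) ^ 2 ∂ρ = taskVar ρ h - taskMar ρ h ^ 2 := by
    have : ∀ w : Vec d, (‖w - h‖ - taskMar ρ h) ^ 2 =
        ‖w - h‖ ^ 2 - 2 * taskMar ρ h * ‖w - h‖ + taskMar ρ h ^ 2 := fun w => by ring
    simp only [this]
    rw [integral_add (by exact h2.sub (h1.const_mul _)) (integrable_const _),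
      integral_sub h2 (h1.const_mul _), integral_const_mul]
    simp only [integral_const, probReal_univ, one_smul]
    rw [← taskMar, ← taskVar]
    ring
  linarith

end Transfer

end BiasOFUL

theorem mainTheorem5 :
    ∃ C : ℝ, 0 < C ∧
      ∀ (d T : ℕ) (lam R L S : ℝ) (h : BiasOFUL.Vec d)
        (ρ : Measure (BiasOFUL.Vec d)) [IsProbabilityMeasure ρ]
        (Ω : Type*) [mΩ : MeasurableSpace Ω]
        (κ : Kernel (BiasOFUL.Vec d) Ω) [IsMarkovKernel κ]
        (𝓕 : Filtration ℕ mΩ)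
        (D : ℕ → BiasOFUL.Vec d → Ω → Set (BiasOFUL.Vec d))
        (η : ℕ → Ω → ℝ)
        (x xstar : ℕ → BiasOFUL.Vec d → Ω → BiasOFUL.Vec d),
        0 < d → 0 < T → 1 ≤ lam → 0 ≤ R → 0 ≤ L →
        -- the bias, the tasks, the arms and the mean rewards are bounded
        ‖h‖ ≤ S →
        (∀ᵐ w ∂ρ, ‖w‖ ≤ S) →
        (∀ᵐ w ∂ρ, ∀ t < T, ∀ ω, ∀ z ∈ D t w ω, ‖z‖ ≤ L) →
        (∀ᵐ w ∂ρ, ∀ t < T, ∀ ω, ∀ z ∈ D t w ω, inner ℝ z w ∈ Set.Icc (-1 : ℝ) 1) →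
        -- the noise is conditionally sub-Gaussian given the past
        (∀ t < T, Measurable[𝓕 (t + 1)] (η t)) →
        (∀ᵐ w ∂ρ, ∀ t < T, BiasOFUL.CondSubgaussian (𝓕 t) (η t) R (κ w)) →
        -- the arms are those of BIAS-OFUL, and are chosen from the past
        (∀ t < T, Measurable (Function.uncurry (x t))) →
        (∀ᵐ w ∂ρ, ∀ t < T, Measurable[𝓕 t] (x t w)) →
        (∀ᵐ w ∂ρ, ∀ ω, BiasOFUL.IsRun T lam R h w (fun t => D t w ω) (fun t => η t ω)
          (fun t => x t w ω)) →
        -- the competitor is the optimal policy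
        (∀ t < T, Measurable (Function.uncurry (xstar t))) →
        (∀ᵐ w ∂ρ, ∀ t < T, ∀ ω, xstar t w ω ∈ D t w ω ∧
          IsMaxOn (fun z => inner ℝ z w) (D t w ω) (xstar t w ω)) →
        Integrable (fun p : BiasOFUL.Vec d × Ω => BiasOFUL.pseudoRegret T p.1
            (fun t => xstar t p.1 p.2) (fun t => x t p.1 p.2)) (ρ ⊗ₘ κ) ∧
        BiasOFUL.transferRegret T ρ κ xstar x ≤
          max 1 L ^ 2 *
            (C * √(T * d * lam * Real.log (1 + T * L / (lam * d))) * BiasOFUL.taskMar ρ h +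
              R * C * d * √(T * Real.log (T + T ^ 2 * L / (lam * d)) *
                Real.log (1 + T * L / (lam * d)))) ∧
        C * √(T * d * lam * Real.log (1 + T * L / (lam * d))) * BiasOFUL.taskMar ρ h +
            R * C * d * √(T * Real.log (T + T ^ 2 * L / (lam * d)) *
              Real.log (1 + T * L / (lam * d))) ≤
          C * √(T * d * lam * Real.log (1 + T * L / (lam * d)) * BiasOFUL.taskVar ρ h) +
            R * C * d * √(T * Real.log (T + T ^ 2 * L / (lam * d)) *
              Real.log (1 + T * L / (lam * d))) := by

  refine ⟨8, by norm_num, ?_⟩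
  intro d T lam R L S h ρ _ Ω mΩ κ _ 𝓕 D η x xstar hd hT hlam hR hL _ hS hDL hD1 hη hsub hxm hxF
    hrun hxsm hstar
  have hreg : Measurable fun p : BiasOFUL.Vec d × Ω => BiasOFUL.pseudoRegret T p.1
      (fun t => xstar t p.1 p.2) (fun t => x t p.1 p.2) := by
    refine Finset.measurable_sum _ fun t ht => ?_
    have h1 := hxm t (Finset.mem_range.1 ht)
    have h2 := hxsm t (Finset.mem_range.1 ht)
    exact (h2.sub h1).inner measurable_fst
  have hint : Integrable (fun p : BiasOFUL.Vec d × Ω => BiasOFUL.pseudoRegret T p.1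
      (fun t => xstar t p.1 p.2) (fun t => x t p.1 p.2)) (ρ ⊗ₘ κ) := by
    -- Mean rewards lie in `[-1, 1]`, so each round contributes at most `2` in absolute value.
    refine Integrable.of_bound hreg.aestronglyMeasurable (∑ _ ∈ Finset.range T, 2) ?_
    refine Measure.ae_compProd_of_ae_ae (measurableSet_le hreg.norm measurable_const) ?_
    filter_upwards [hD1, hrun, hstar] with w h1 h2 h3
    refine Filter.Eventually.of_forall fun ω => (norm_sum_le _ _).trans ?_
    refine Finset.sum_le_sum fun t ht => ?_
    have ht := Finset.mem_range.1 ht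
    have h4 := h1 t ht ω _ (h2 ω t ht).1
    have h5 := h1 t ht ω _ (h3 t ht ω).1
    rw [inner_sub_left, Real.norm_eq_abs, abs_le]
    constructor <;> linarith [h4.1, h4.2, h5.1, h5.2]
  have hl0 : 0 ≤ Real.log (1 + T * L / (lam * d)) :=
    Real.log_nonneg (by have : 0 ≤ T * L / (lam * d) := by positivity
                        linarith)
  refine ⟨hint, ?_, ?_⟩
  · have hn : Integrable (fun w => ‖w - h‖) ρ := by
      simpa using BiasOFUL.integrable_norm_sub_pow hS h 1
    have hae := (Measure.integrable_compProd_iff hint.aestronglyMeasurable).1 hint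
    have hinner : Integrable (fun w => ∫ ω, BiasOFUL.pseudoRegret T w (fun t => xstar t w ω)
        (fun t => x t w ω) ∂(κ w)) ρ := by
      rw [Measure.compProd] at hint
      simpa using hint.integral_compProd
    calc BiasOFUL.transferRegret T ρ κ xstar x
        ≤ ∫ w, max 1 L ^ 2 * (8 * √(T * d * lam * Real.log (1 + T * L / (lam * d))) * ‖w - h‖ +
          R * 8 * d * √(T * Real.log (T + T ^ 2 * L / (lam * d)) *
            Real.log (1 + T * L / (lam * d)))) ∂ρ := by
          refine integral_mono_ae hinner
            (((hn.const_mul _).add (integrable_const _)).const_mul _) ?_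
          filter_upwards [hDL, hsub, hxF, hrun, hstar, hae.1] with w h1 h2 h3 h4 h5 h6
          exact BiasOFUL.integral_pseudoRegret_le hd hT hlam hR hL h w h3 hη h2 h1 h4
            (fun t ht ω => (h5 t ht ω).1) h6
      _ = _ := by
          rw [integral_const_mul, integral_add (hn.const_mul _) (integrable_const _),
            integral_const_mul]
          simp [BiasOFUL.taskMar]
  · rw [Real.sqrt_mul (by positivity) (BiasOFUL.taskVar ρ h), ← mul_assoc]
    gcongr
    exact BiasOFUL.taskMar_le_sqrt_taskVar hS h

end
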